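/- For an integer $s\ge 1$ let $B(s,\lambda)=\frac{\lambda^s/s!}{\sum_{k=0}^s\lambda^k/k!}$ be the Erlang B formula, which is the rejection probability $D_F^R(s,\lambda)$ of the $s$-server system in the loss case $F\equiv 0$ (no customer that finds all servers busy is admitted), and let $$f_s(\delta)=\sqrt s\,\Bigl(1-\frac{\delta}{\sqrt s}\Bigr)B(s,s-\delta\sqrt s),\qquad \delta\le\sqrt s .$$ For every $\gamma\in(0,\sqrt s)$ Cohen's equation $a=f_s(\gamma-a)$ has a unique solution $a=a_s(\gamma)\ge 0$. Put $$L_s(\gamma)=\frac{(\sqrt s-\gamma)^2}{\sqrt s-\gamma+a_s(\gamma)},\qquad 0<\gamma<\sqrt s .$$ Then, for every integer $s\ge1$ and with implied constants that do not depend on $s$, $$L_s(\gamma)\in(0,\sqrt s-\gamma)\quad(0<\gamma<\sqrt s),$$ $$L_s(\gamma)=\gamma s\,\bigl(1+O(\gamma\sqrt s)\bigr)\quad(\gamma\downarrow0),$$ $$L_s(\gamma)=(\sqrt s-\gamma)\Bigl(1+O\Bigl(\frac{e^s}{\sqrt s}\Bigl(1-\frac{\gamma}{\sqrt s}\Bigr)^s\Bigr)\Bigr)\quad(\gamma\uparrow\sqrt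 s).$$ The equation $\gamma\,a_s(\gamma)=\frac12\bigl(1-\frac{\gamma}{\sqrt s}\bigr)$ has a unique solution $\gamma=\hat\gamma_s$ in $(0,\sqrt s)$. The function $L_s$ is unimodal: it is strictly increasing on $(0,\hat\gamma_s]$ and strictly decreasing on $[\hat\gamma_s,\sqrt s)$, so that its maximum on $(0,\sqrt s)$ is attained exactly at $\hat\gamma_s$; the maximum value is $$L_s(\hat\gamma_s)=\frac{\hat\gamma_s}{\hat\gamma_s+\frac1{2\sqrt s}}\,(\sqrt s-\hat\gamma_s).$$ Moreover, for $s\ge2$, $$\hat\gamma_s>f_s(0)>\Bigl(\frac12+\frac1{16s}\Bigr)^{1/2}-\frac1{4\sqrt s}.$$ Finally, $\hat\gamma_s$ is strictly increasing in $s\ge1$, with $\hat\gamma_1=\frac12$, $|\hat\gamma_{550}-1|<10^{-3}$, and $\hat\gamma_s\to\hat\gamma_\infty$ as $s\to\infty$, where $1.0341134595<\hat\gamma_\infty<1.0341134596$. -/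

import Mathlib

open Set Filter Topology

noncomputable section

/-- The Erlang B formula: blocking probability of the `M/M/s/s` system with offered load `lam`. -/
def erlangB (s : ℕ) (lam : ℝ) : ℝ :=
  (lam ^ s / (s.factorial : ℝ)) /
    ∑ k ∈ Finset.range (s + 1), lam ^ k / (k.factorial : ℝ)

/-- The stationary rejection probability `D_F^R(s, lam)` of the `s`-server system whose admission
policy `(p_k)_{k ≥ s}` has the generating function `F(x) = ∑ₙ p_s ⋯ p_{s+n} x^(n+1)`. -/
def rejectionProb (s : ℕ) (F : ℝ → ℝ) (lam : ℝ) : ℝ :=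
  (1 + (1 - s / lam) * F (lam / s)) / ((erlangB s lam)⁻¹ + F (lam / s))

/-- `f_{s,F}^R(δ) = √s (1 - δ/√s) D_F^R(s, s - δ√s)`. -/
def scaledRejection (s : ℕ) (F : ℝ → ℝ) (δ : ℝ) : ℝ :=
  √s * (1 - δ / √s) * rejectionProb s F (s - δ * √s)

/-- The function `f_s` of the loss system, in which `p_k = 0` for all `k ≥ s`, so `F ≡ 0`. -/
def lossF (s : ℕ) (δ : ℝ) : ℝ := scaledRejection s (fun _ => 0) δ

theorem lossF_eq (s : ℕ) (δ : ℝ) :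
    lossF s δ = √s * (1 - δ / √s) * erlangB s (s - δ * √s) := by
  simp [lossF, scaledRejection, rejectionProb]

/-- `a` solves Cohen's equation `a = f_s(γ - a)`. Here `a√s` is the rate of reattempts, so it is
nonnegative; for `γ < √s` this also keeps `γ - a` in the domain `(-∞, √s]` of `f_s`. -/
def IsCohenSolution (s : ℕ) (γ a : ℝ) : Prop := 0 ≤ a ∧ a = lossF s (γ - a)

/-- `a_s(γ)`, the solution of Cohen's equation. -/
def cohenSol (s : ℕ) (γ : ℝ) : ℝ := Classical.epsilon (IsCohenSolution s γ)

/-- `L_s(γ) = (√s - γ)² / (√s - γ + a_s(γ))`. -/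
def carriedL (s : ℕ) (γ : ℝ) : ℝ := (√s - γ) ^ 2 / (√s - γ + cohenSol s γ)

end

/-!
Parametrize by the total offered load `λ`. If `C = λ (1 - B(s, λ))` is the carried load, then
`γ = (s - C) / √s` and `a_s(γ) = (λ - C) / √s`, so that `L_s(γ) = C² / (λ √s)`. Its critical points
are the zeros of `2 (s - C) (λ - C) - C`, the equation for `γ̂_s`. At each zero this function of `λ`
has a positive derivative, so there is only one, and `L_s` is unimodal.

For the monotonicity in `s`, the reciprocal `1 / f_s(δ)` is the mass `∫₀^∞ exp (δ y - R_ε(y)) dy`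
with `R_ε(y) = ∫₀^y u / (1 + ε u) du` and `ε = 1 / √s`, which makes sense for every real `ε ≥ 0`.
Fix `γ` and choose `a` so that the equation `γ a = (1 - γ ε) / 2` holds; then `γ = γ̂_s` means that
`a` times the mass at `δ = γ - a` is `1`. As `ε` increases, this product can cross `1` only upwards,
by Cauchy–Schwarz for the derivative of the mass and the recursion for its moments. At `ε = 0` the
mass is Gaussian, which gives the limit.
-/

section Upcrossing

/-- `F` changes sign from negative to positive at `z`; nothing is required of the value `F z`. -/
def IsUpcrossing (F : ℝ → ℝ) (z : ℝ) : Prop :=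
  ∀ᶠ x in 𝓝 z, (x < z → F x < 0) ∧ (z < x → 0 < F x)

variable {F : ℝ → ℝ}

theorem isUpcrossing_of_hasDerivAt_pos {F' z : ℝ} (hF : HasDerivAt F F' z) (hz : F z = 0)
    (hF' : 0 < F') : IsUpcrossing F z := by
  filter_upwards [eventually_nhdsWithin_sign_eq_of_deriv_pos (hF.deriv.symm ▸ hF') hz] with x hx
  refine ⟨fun hlt => ?_, fun hlt => ?_⟩
  · rwa [sign_neg (sub_neg.2 hlt), sign_eq_neg_one_iff] at hx
  · rwa [sign_pos (sub_pos.2 hlt), sign_eq_one_iff] at hx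

theorem nonneg_of_isUpcrossing {x₀ x₁ : ℝ} (hF : ContinuousOn F (Icc x₀ x₁))
    (hup : ∀ z ∈ Icc x₀ x₁, F z = 0 → IsUpcrossing F z) (h₀ : 0 ≤ F x₀) :
    ∀ x ∈ Icc x₀ x₁, 0 ≤ F x := by
  have hclosed : IsClosed ({x | 0 ≤ F x} ∩ Icc x₀ x₁) := by
    rw [inter_comm]
    exact hF.preimage_isClosed_of_isClosed isClosed_Icc isClosed_Ici
  refine hclosed.Icc_subset_of_forall_exists_gt h₀ fun x ⟨hFx, hx⟩ y hxy => ?_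
  have hpos : ∀ᶠ u in 𝓝[>] x, 0 ≤ F u := by
    rcases (show 0 ≤ F x from hFx).eq_or_lt with hzero | hFx
    · filter_upwards [(hup x (Ico_subset_Icc_self hx) hzero.symm).filter_mono
        nhdsWithin_le_nhds, self_mem_nhdsWithin] with u hu hxu using (hu.2 hxu).le
    · have hcont := (hF x (Ico_subset_Icc_self hx)).mono_of_mem_nhdsWithin
        (Icc_mem_nhdsGT_of_mem hx)
      exact (hcont.eventually (lt_mem_nhds hFx)).mono fun _ => le_of_lt
  obtain ⟨u, hu, huy⟩ := (hpos.and (Ioc_mem_nhdsGT hxy)).exists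
  exact ⟨u, hu, huy⟩

theorem pos_of_isUpcrossing {x₀ x₁ : ℝ} (h₀₁ : x₀ < x₁) (hF : ContinuousOn F (Icc x₀ x₁))
    (hup : ∀ z ∈ Icc x₀ x₁, F z = 0 → IsUpcrossing F z) (h₀ : 0 ≤ F x₀) : 0 < F x₁ := by
  have hnonneg := nonneg_of_isUpcrossing hF hup h₀
  refine (hnonneg x₁ (right_mem_Icc.2 h₀₁.le)).lt_of_ne' fun hzero => ?_
  have hneg := ((hup x₁ (right_mem_Icc.2 h₀₁.le) hzero).filter_mono nhdsWithin_le_nhds).and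
    (Ioo_mem_nhdsLT h₀₁)
  obtain ⟨u, hu, hu₀₁⟩ := hneg.exists
  exact (hu.1 hu₀₁.2).not_ge (hnonneg u (Ioo_subset_Icc_self hu₀₁))

end Upcrossing

section Erlang

variable {s : ℕ} {lam : ℝ}

theorem sum_pow_div_factorial_pos (s : ℕ) (h : 0 < lam) :
    0 < ∑ k ∈ Finset.range (s + 1), lam ^ k / (k.factorial : ℝ) :=
  Finset.sum_pos (fun k _ => by positivity) Finset.nonempty_range_add_one

theorem erlangB_zero (lam : ℝ) : erlangB 0 lam = 1 := by simp [erlangB]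

theorem erlangB_pos (s : ℕ) (h : 0 < lam) : 0 < erlangB s lam :=
  div_pos (by positivity) (sum_pow_div_factorial_pos s h)

theorem erlangB_succ (s : ℕ) (h : 0 < lam) :
    erlangB (s + 1) lam = lam * erlangB s lam / (s + 1 + lam * erlangB s lam) := by
  have := sum_pow_div_factorial_pos s h
  have hterm : lam ^ (s + 1) / ((s + 1).factorial : ℝ) =
      lam * (lam ^ s / (s.factorial : ℝ)) / (s + 1) := by
    rw [Nat.factorial_succ, pow_succ]
    push_cast
    field_simp
  have hterm_pos : 0 < lam ^ s / (s.factorial : ℝ) := by positivity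
  unfold erlangB
  rw [Finset.sum_range_succ _ (s + 1), hterm]
  generalize lam ^ s / (s.factorial : ℝ) = t at *
  field_simp

theorem erlangB_le_one (s : ℕ) (h : 0 < lam) : erlangB s lam ≤ 1 :=
  div_le_one_of_le₀ (Finset.single_le_sum (f := fun k : ℕ => lam ^ k / (k.factorial : ℝ))
    (fun k _ => by positivity) (Finset.self_mem_range_succ s)) (sum_pow_div_factorial_pos s h).le

theorem erlangB_le_self (hs : 1 ≤ s) (h : 0 < lam) : erlangB s lam ≤ lam := by
  obtain ⟨s, rfl⟩ := Nat.exists_eq_add_of_le' hs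
  have hB := erlangB_pos s h
  rw [erlangB_succ s h]
  calc lam * erlangB s lam / (s + 1 + lam * erlangB s lam)
      ≤ lam * erlangB s lam := div_le_self (by positivity) (le_add_of_le_of_nonneg
        (by linarith [s.cast_nonneg (α := ℝ)]) (by positivity))
    _ ≤ lam := mul_le_of_le_one_right h.le (erlangB_le_one s h)

theorem erlangB_le_pow_div_factorial (s : ℕ) (h : 0 < lam) :
    erlangB s lam ≤ lam ^ s / s.factorial := by
  refine div_le_self (by positivity) ?_
  simpa using Finset.single_le_sum (f := fun k : ℕ => lam ^ k / (k.factorial : ℝ))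
    (fun k _ => by positivity) (Finset.mem_range.2 s.succ_pos)

/-- The carried load of the loss system with `s` servers and offered load `lam`, i.e. its mean
number of busy servers. -/
noncomputable def carriedLoad (s : ℕ) (lam : ℝ) : ℝ := lam * (1 - erlangB s lam)

theorem carriedLoad_zero (lam : ℝ) : carriedLoad 0 lam = 0 := by
  simp [carriedLoad, erlangB_zero]

theorem sub_carriedLoad (s : ℕ) (lam : ℝ) : lam - carriedLoad s lam = lam * erlangB s lam := by
  rw [carriedLoad]
  ring

theorem carriedLoad_lt_self (s : ℕ) (h : 0 < lam) : carriedLoad s lam < lam :=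
  sub_pos.1 (sub_carriedLoad s lam ▸ mul_pos h (erlangB_pos s h))

theorem succ_add_sub_carriedLoad_pos (s : ℕ) (h : 0 < lam) :
    0 < s + 1 + (lam - carriedLoad s lam) := by
  have := carriedLoad_lt_self s h
  have := s.cast_nonneg (α := ℝ)
  linarith

theorem carriedLoad_succ (s : ℕ) (h : 0 < lam) :
    carriedLoad (s + 1) lam = (s + 1) * lam / (s + 1 + (lam - carriedLoad s lam)) := by
  have hB := erlangB_pos s h
  rw [sub_carriedLoad, carriedLoad, erlangB_succ s h]
  field_simp
  ring

theorem carriedLoad_pos (hs : 1 ≤ s) (h : 0 < lam) : 0 < carriedLoad s lam := by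
  obtain ⟨s, rfl⟩ := Nat.exists_eq_add_of_le' hs
  rw [carriedLoad_succ s h]
  exact div_pos (by positivity) (succ_add_sub_carriedLoad_pos s h)

theorem sub_carriedLoad_succ_mul (s : ℕ) (h : 0 < lam) :
    (s + 1 - carriedLoad (s + 1) lam) * lam =
      carriedLoad (s + 1) lam * (s + 1 - carriedLoad s lam) := by
  have hD := succ_add_sub_carriedLoad_pos s h
  rw [carriedLoad_succ s h]
  field_simp
  ring

theorem carriedLoad_le (s : ℕ) (h : 0 < lam) : carriedLoad s lam ≤ s := by
  induction s with
  | zero => simp [carriedLoad_zero]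
  | succ s ih =>
    refine sub_nonneg.1 (nonneg_of_mul_nonneg_left ?_ h)
    rw [Nat.cast_succ, sub_carriedLoad_succ_mul s h]
    exact mul_nonneg (carriedLoad_pos s.succ_pos h).le (by linarith)

theorem carriedLoad_le_sub_mul (hs : 1 ≤ s) (h : 0 < lam) :
    carriedLoad s lam ≤ (s - carriedLoad s lam) * lam := by
  obtain ⟨s, rfl⟩ := Nat.exists_eq_add_of_le' hs
  rw [Nat.cast_succ, sub_carriedLoad_succ_mul s h]
  exact le_mul_of_one_le_right (carriedLoad_pos hs h).le (by linarith [carriedLoad_le s h])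

theorem carriedLoad_lt (hs : 1 ≤ s) (h : 0 < lam) : carriedLoad s lam < s :=
  sub_pos.1 (pos_of_mul_pos_left
    ((carriedLoad_pos hs h).trans_le (carriedLoad_le_sub_mul hs h)) h.le)

theorem carriedLoad_succ_sub_mul (s : ℕ) (h : 0 < lam) :
    carriedLoad (s + 1) lam -
        (lam - carriedLoad (s + 1) lam) * ((s + 1 : ℕ) - carriedLoad (s + 1) lam) =
      (s + 1) * lam * (s + 1 - (lam - carriedLoad s lam) * (s - carriedLoad s lam)) /
        (s + 1 + (lam - carriedLoad s lam)) ^ 2 := by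
  have hD := succ_add_sub_carriedLoad_pos s h
  rw [carriedLoad_succ s h]
  push_cast
  field_simp
  ring

theorem sub_mul_sub_carriedLoad_le (s : ℕ) (h : 0 < lam) :
    (lam - carriedLoad s lam) * (s - carriedLoad s lam) ≤ carriedLoad s lam := by
  induction s with
  | zero => simp [carriedLoad_zero]
  | succ s ih =>
    rw [← sub_nonneg, carriedLoad_succ_sub_mul s h]
    have := carriedLoad_le s h
    exact div_nonneg (mul_nonneg (by positivity) (by linarith)) (sq_nonneg _)

theorem sub_mul_sub_carriedLoad_lt (hs : 1 ≤ s) (h : 0 < lam) :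
    (lam - carriedLoad s lam) * (s - carriedLoad s lam) < carriedLoad s lam := by
  obtain ⟨s, rfl⟩ := Nat.exists_eq_add_of_le' hs
  have := carriedLoad_le s h
  have := sub_mul_sub_carriedLoad_le s h
  rw [← sub_pos, carriedLoad_succ_sub_mul s h]
  exact div_pos (mul_pos (by positivity) (by linarith))
    (pow_pos (succ_add_sub_carriedLoad_pos s h) 2)

theorem hasDerivAt_carriedLoad (s : ℕ) (h : 0 < lam) :
    HasDerivAt (carriedLoad s) ((carriedLoad s lam -
      (lam - carriedLoad s lam) * (s - carriedLoad s lam)) / lam) lam := by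
  induction s with
  | zero =>
    rw [funext carriedLoad_zero]
    simpa using hasDerivAt_const lam (0 : ℝ)
  | succ s ih =>
    have hD := succ_add_sub_carriedLoad_pos s h
    have hderiv := ((hasDerivAt_id' lam).const_mul ((s : ℝ) + 1)).fun_div
      (((hasDerivAt_id' lam).fun_sub ih).const_add ((s : ℝ) + 1)) hD.ne'
    have hsucc : carriedLoad (s + 1) =ᶠ[𝓝 lam]
        fun l => (s + 1) * l / (s + 1 + (l - carriedLoad s l)) := by
      filter_upwards [lt_mem_nhds h] with l hl using carriedLoad_succ s hl
    refine (hderiv.congr_of_eventuallyEq hsucc).congr_deriv ?_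
    rw [carriedLoad_succ s h]
    push_cast
    field_simp
    ring

theorem continuousOn_carriedLoad (s : ℕ) : ContinuousOn (carriedLoad s) (Ioi 0) := fun _ h =>
  (hasDerivAt_carriedLoad s h).continuousAt.continuousWithinAt

theorem strictMonoOn_carriedLoad (hs : 1 ≤ s) : StrictMonoOn (carriedLoad s) (Ioi 0) := by
  refine strictMonoOn_of_deriv_pos (convex_Ioi 0) (continuousOn_carriedLoad s) fun x hx => ?_
  rw [interior_Ioi] at hx
  rw [(hasDerivAt_carriedLoad s hx).deriv]
  exact div_pos (sub_pos.2 (sub_mul_sub_carriedLoad_lt hs hx)) hx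

theorem exists_carriedLoad_eq {c : ℝ} (hc : 0 < c) (hcs : c < s) :
    ∃ lam, 0 < lam ∧ carriedLoad s lam = c := by
  have hs : (0 : ℝ) < s := hc.trans hcs
  have hsc : 0 < s - c := sub_pos.2 hcs
  set M := s + s / (s - c) with hM
  have hsM : (s : ℝ) < M := lt_add_of_pos_right _ (by positivity)
  have hcM : c ≤ carriedLoad s M := by
    by_contra! hlt
    have hle := sub_mul_sub_carriedLoad_le s (hs.trans hsM)
    have : (M - s) * (s - c) ≤ (M - carriedLoad s M) * (s - carriedLoad s M) :=
      mul_le_mul (by linarith) (by linarith) hsc.le (by linarith)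
    have : (M - s) * (s - c) = s := by
      rw [hM]
      field_simp
      ring
    linarith
  have hsub : Icc c M ⊆ Ioi 0 := fun x hx => hc.trans_le hx.1
  obtain ⟨lam, hlam, heq⟩ := intermediate_value_Icc (hcs.trans hsM).le
    ((continuousOn_carriedLoad s).mono hsub) ⟨(carriedLoad_lt_self s hc).le, hcM⟩
  exact ⟨lam, hsub hlam, heq⟩

/-- Up to a negative factor, the derivative of `lam ↦ carriedLoad s lam ^ 2 / lam`. It is the sign
of this quantity that tells on which side of the optimum the offered load `lam` lies. -/
noncomputable def overloadGap (s : ℕ) (lam : ℝ) : ℝ :=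
  2 * (s - carriedLoad s lam) * (lam - carriedLoad s lam) - carriedLoad s lam

theorem overloadGap_zero (lam : ℝ) : overloadGap 0 lam = 0 := by
  simp [overloadGap, carriedLoad_zero]

theorem overloadGap_succ (s : ℕ) (h : 0 < lam) :
    overloadGap (s + 1) lam = (s + 1) * lam * (overloadGap s lam + lam - (s + 1)) /
      (s + 1 + (lam - carriedLoad s lam)) ^ 2 := by
  have hD := succ_add_sub_carriedLoad_pos s h
  rw [overloadGap, overloadGap, carriedLoad_succ s h]
  push_cast
  field_simp
  ring

theorem overloadGap_succ_pos_iff (s : ℕ) (h : 0 < lam) :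
    0 < overloadGap (s + 1) lam ↔ s + 1 < overloadGap s lam + lam := by
  have hD := succ_add_sub_carriedLoad_pos s h
  rw [overloadGap_succ s h, div_pos_iff_of_pos_right (by positivity),
    mul_pos_iff_of_pos_left (by positivity), sub_pos]

theorem overloadGap_nonneg (h : 0 < lam) (hlam : s ≤ lam) : 0 ≤ overloadGap s lam := by
  induction s with
  | zero => rw [overloadGap_zero]
  | succ s ih =>
    push_cast at hlam
    have hgap := ih (by linarith)
    rw [overloadGap_succ s h]
    exact div_nonneg (mul_nonneg (by positivity) (by linarith)) (sq_nonneg _)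

theorem overloadGap_pos_of_lt (hs : 1 ≤ s) (hlam : s < lam) : 0 < overloadGap s lam := by
  obtain ⟨s, rfl⟩ := Nat.exists_eq_add_of_le' hs
  push_cast at hlam
  have h : 0 < lam := by linarith [s.cast_nonneg (α := ℝ)]
  have hgap := overloadGap_nonneg (s := s) h (by linarith)
  exact (overloadGap_succ_pos_iff s h).2 (by linarith)

theorem overloadGap_self_pos (hs : 2 ≤ s) : 0 < overloadGap s s := by
  obtain ⟨s, rfl⟩ := Nat.exists_eq_add_of_le' hs
  have hgap : 0 < overloadGap (s + 1) (s + 2 : ℕ) :=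
    overloadGap_pos_of_lt (Nat.le_add_left 1 s) (by push_cast; linarith)
  refine (overloadGap_succ_pos_iff (s + 1) (by positivity)).2 ?_
  push_cast at hgap ⊢
  linarith

theorem overloadGap_le_self (s : ℕ) (h : 0 < lam) : overloadGap s lam ≤ lam := by
  rw [overloadGap]
  linarith [sub_mul_sub_carriedLoad_le s h, carriedLoad_lt_self s h]

theorem overloadGap_half_nonpos (hs : 1 ≤ s) : overloadGap s (s / 2) ≤ 0 := by
  obtain ⟨s, rfl⟩ := Nat.exists_eq_add_of_le' hs
  have h : (0 : ℝ) < (s + 1 : ℕ) / 2 := by positivity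
  have hgap := overloadGap_le_self s h
  refine not_lt.1 fun hpos => ?_
  rw [overloadGap_succ_pos_iff s h] at hpos
  push_cast at hpos hgap
  linarith

theorem continuousOn_overloadGap (s : ℕ) : ContinuousOn (overloadGap s) (Ioi 0) := by
  have := continuousOn_carriedLoad s
  unfold overloadGap
  fun_prop

theorem isUpcrossing_overloadGap (hs : 1 ≤ s) (h : 0 < lam) (hgap : overloadGap s lam = 0) :
    IsUpcrossing (overloadGap s) lam := by
  have hlam : lam ≤ s := not_lt.1 fun hlt => (overloadGap_pos_of_lt hs hlt).ne' hgap
  have hC := hasDerivAt_carriedLoad s h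
  have hderiv := (((hC.const_sub (s : ℝ)).const_mul 2).fun_mul
    ((hasDerivAt_id' lam).fun_sub hC)).fun_sub hC
  have hderiv' : HasDerivAt (overloadGap s) ((s - carriedLoad s lam) *
      (lam - carriedLoad s lam) * (1 + 2 * (s - lam)) / lam) lam := by
    refine hderiv.congr_deriv ?_
    rw [overloadGap] at hgap
    generalize carriedLoad s lam = c at *
    field_simp
    linear_combination (2 * (lam - c) + 1) * hgap
  refine isUpcrossing_of_hasDerivAt_pos hderiv' hgap (div_pos (mul_pos (mul_pos ?_ ?_) ?_) h)
  · exact sub_pos.2 (carriedLoad_lt hs h)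
  · exact sub_pos.2 (carriedLoad_lt_self s h)
  · linarith

theorem overloadGap_pos_of_nonneg_of_lt (hs : 1 ≤ s) {x y : ℝ} (hx : 0 < x) (hxy : x < y)
    (hgap : 0 ≤ overloadGap s x) : 0 < overloadGap s y := by
  have hsub : Icc x y ⊆ Ioi (0 : ℝ) := fun t ht => hx.trans_le ht.1
  exact pos_of_isUpcrossing hxy ((continuousOn_overloadGap s).mono hsub)
    (fun z hz => isUpcrossing_overloadGap hs (hsub hz)) hgap

theorem exists_overloadGap_eq_zero (hs : 1 ≤ s) : ∃ lam, 0 < lam ∧ overloadGap s lam = 0 := by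
  have hs0 : (0 : ℝ) < s := by exact_mod_cast hs
  have hsub : Icc ((s : ℝ) / 2) (s + 1) ⊆ Ioi (0 : ℝ) := fun x hx => (half_pos hs0).trans_le hx.1
  obtain ⟨lam, hlam, hgap⟩ := intermediate_value_Icc (by linarith)
    ((continuousOn_overloadGap s).mono hsub)
    ⟨overloadGap_half_nonpos hs, (overloadGap_pos_of_lt hs (lt_add_one _)).le⟩
  exact ⟨lam, hsub hlam, hgap⟩

/-- The offered load at which `overloadGap s` vanishes, i.e. at which
`carriedLoad s lam ^ 2 / lam` is maximal (an arbitrary number for `s = 0`). -/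
noncomputable def optLoad (s : ℕ) : ℝ :=
  Classical.epsilon fun lam => 0 < lam ∧ overloadGap s lam = 0

theorem optLoad_pos (hs : 1 ≤ s) : 0 < optLoad s :=
  (Classical.epsilon_spec (exists_overloadGap_eq_zero hs)).1

theorem overloadGap_optLoad (hs : 1 ≤ s) : overloadGap s (optLoad s) = 0 :=
  (Classical.epsilon_spec (exists_overloadGap_eq_zero hs)).2

theorem overloadGap_pos_iff (hs : 1 ≤ s) (h : 0 < lam) :
    0 < overloadGap s lam ↔ optLoad s < lam := by
  refine ⟨fun hgap => ?_, fun hlt =>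
    overloadGap_pos_of_nonneg_of_lt hs (optLoad_pos hs) hlt (overloadGap_optLoad hs).ge⟩
  by_contra! hle
  rcases hle.eq_or_lt with rfl | hlt
  · exact hgap.ne' (overloadGap_optLoad hs)
  · exact (overloadGap_pos_of_nonneg_of_lt hs h hlt hgap.le).ne' (overloadGap_optLoad hs)

theorem overloadGap_nonneg_iff (hs : 1 ≤ s) (h : 0 < lam) :
    0 ≤ overloadGap s lam ↔ optLoad s ≤ lam := by
  refine ⟨fun hgap => not_lt.1 fun hlt => ?_, fun hle => ?_⟩
  · exact (overloadGap_pos_of_nonneg_of_lt hs h hlt hgap).ne' (overloadGap_optLoad hs)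
  · rcases hle.eq_or_lt with rfl | hlt
    · exact (overloadGap_optLoad hs).ge
    · exact ((overloadGap_pos_iff hs h).2 hlt).le

theorem overloadGap_neg_iff (hs : 1 ≤ s) (h : 0 < lam) :
    overloadGap s lam < 0 ↔ lam < optLoad s := by
  rw [← not_le, ← not_le, overloadGap_nonneg_iff hs h]

theorem overloadGap_eq_zero_iff (hs : 1 ≤ s) (h : 0 < lam) :
    overloadGap s lam = 0 ↔ lam = optLoad s := by
  rw [le_antisymm_iff, le_antisymm_iff, overloadGap_nonneg_iff hs h, ← not_lt,
    overloadGap_pos_iff hs h, not_lt]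

theorem optLoad_le (hs : 1 ≤ s) : optLoad s ≤ s := by
  have hs0 : (0 : ℝ) < s := by exact_mod_cast hs
  exact (overloadGap_nonneg_iff hs hs0).1 (overloadGap_nonneg hs0 le_rfl)

theorem hasDerivAt_carriedLoad_sq_div (s : ℕ) (h : 0 < lam) :
    HasDerivAt (fun l => carriedLoad s l ^ 2 / l)
      (-(carriedLoad s lam * overloadGap s lam) / lam ^ 2) lam := by
  refine (((hasDerivAt_carriedLoad s h).fun_pow 2).fun_div (hasDerivAt_id' lam)
    h.ne').congr_deriv ?_
  rw [overloadGap]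
  field_simp
  ring

theorem strictMonoOn_carriedLoad_sq_div (hs : 1 ≤ s) :
    StrictMonoOn (fun l => carriedLoad s l ^ 2 / l) (Ioc 0 (optLoad s)) := by
  refine strictMonoOn_of_deriv_pos (convex_Ioc 0 _) (fun x hx =>
    (hasDerivAt_carriedLoad_sq_div s hx.1).continuousAt.continuousWithinAt) fun x hx => ?_
  rw [interior_Ioc] at hx
  rw [(hasDerivAt_carriedLoad_sq_div s hx.1).deriv]
  have hgap := (overloadGap_neg_iff hs hx.1).2 hx.2
  exact div_pos (neg_pos.2 (mul_neg_of_pos_of_neg (carriedLoad_pos hs hx.1) hgap))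
    (pow_pos hx.1 2)

theorem strictAntiOn_carriedLoad_sq_div (hs : 1 ≤ s) :
    StrictAntiOn (fun l => carriedLoad s l ^ 2 / l) (Ici (optLoad s)) := by
  refine strictAntiOn_of_deriv_neg (convex_Ici _) (fun x hx => (hasDerivAt_carriedLoad_sq_div s
    ((optLoad_pos hs).trans_le hx)).continuousAt.continuousWithinAt) fun x hx => ?_
  rw [interior_Ici] at hx
  have hx0 : 0 < x := (optLoad_pos hs).trans hx
  rw [(hasDerivAt_carriedLoad_sq_div s hx0).deriv]
  have hgap := (overloadGap_pos_iff hs hx0).2 hx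
  exact div_neg_of_neg_of_pos (neg_neg_of_pos (mul_pos (carriedLoad_pos hs hx0) hgap))
    (pow_pos hx0 2)

end Erlang

section CohenEquation

variable {s : ℕ} {lam γ : ℝ}

theorem sqrt_natCast_pos (hs : 1 ≤ s) : 0 < √(s : ℝ) :=
  Real.sqrt_pos.2 (by exact_mod_cast hs)

theorem lossF_mul_sqrt (hs : 1 ≤ s) (δ : ℝ) :
    lossF s δ * √s = (s - δ * √s) - carriedLoad s (s - δ * √s) := by
  have hr := sqrt_natCast_pos hs
  rw [sub_carriedLoad, lossF_eq, mul_right_comm]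
  congr 1
  field_simp
  rw [mul_sub, Real.mul_self_sqrt s.cast_nonneg, mul_comm]

theorem isCohenSolution_iff (hs : 1 ≤ s) (γ a : ℝ) :
    IsCohenSolution s γ a ↔ 0 ≤ a ∧ carriedLoad s (s - (γ - a) * √s) = s - γ * √s := by
  have hloss := lossF_mul_sqrt hs (γ - a)
  rw [IsCohenSolution, ← mul_left_inj' (sqrt_natCast_pos hs).ne', hloss]
  refine and_congr_right fun _ => ⟨fun h => ?_, fun h => ?_⟩ <;> linarith

/-- The scaled expected number `(s - carriedLoad s lam) / √s` of idle servers. It is the parameter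
`γ` of the system with reattempts whose total offered load is `lam`. -/
noncomputable def slack (s : ℕ) (lam : ℝ) : ℝ := (s - carriedLoad s lam) / √s

theorem slack_mul_sqrt (hs : 1 ≤ s) (lam : ℝ) : slack s lam * √s = s - carriedLoad s lam :=
  div_mul_cancel₀ _ (sqrt_natCast_pos hs).ne'

theorem sqrt_sub_slack (s : ℕ) (lam : ℝ) : √s - slack s lam = carriedLoad s lam / √s := by
  rw [slack, sub_div, Real.div_sqrt, sub_sub_cancel]

theorem one_sub_slack_div_sqrt (hs : 1 ≤ s) (lam : ℝ) :
    1 - slack s lam / √s = carriedLoad s lam / s := by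
  have hs0 : (s : ℝ) ≠ 0 := by positivity
  rw [slack, div_div, Real.mul_self_sqrt s.cast_nonneg, sub_div, div_self hs0, sub_sub_cancel]

theorem strictAntiOn_slack (hs : 1 ≤ s) : StrictAntiOn (slack s) (Ioi 0) := fun _ hx _ hy hxy =>
  div_lt_div_of_pos_right (sub_lt_sub_left (strictMonoOn_carriedLoad hs hx hy hxy) _)
    (sqrt_natCast_pos hs)

theorem slack_mem_Ioo (hs : 1 ≤ s) (h : 0 < lam) : slack s lam ∈ Ioo 0 √(s : ℝ) := by
  have hr := sqrt_natCast_pos hs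
  refine ⟨div_pos (sub_pos.2 (carriedLoad_lt hs h)) hr, sub_pos.1 ?_⟩
  rw [sqrt_sub_slack]
  exact div_pos (carriedLoad_pos hs h) hr

theorem exists_slack_eq (hγ : γ ∈ Ioo 0 √(s : ℝ)) : ∃ lam, 0 < lam ∧ slack s lam = γ := by
  have hr : 0 < √(s : ℝ) := hγ.1.trans hγ.2
  have hcast : √(s : ℝ) * √s = s := Real.mul_self_sqrt s.cast_nonneg
  obtain ⟨lam, h, hC⟩ := exists_carriedLoad_eq (s := s) (c := (√s - γ) * √s)
    (mul_pos (sub_pos.2 hγ.2) hr)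
    (by rw [sub_mul, hcast]; exact sub_lt_self _ (mul_pos hγ.1 hr))
  refine ⟨lam, h, ?_⟩
  rw [slack, hC, div_eq_iff hr.ne', sub_mul, hcast, sub_sub_cancel]

theorem isCohenSolution_slack_iff (hs : 1 ≤ s) (h : 0 < lam) (a : ℝ) :
    IsCohenSolution s (slack s lam) a ↔ a = (lam - carriedLoad s lam) / √s := by
  have hr := sqrt_natCast_pos hs
  have hload : (s : ℝ) - (slack s lam - a) * √s = carriedLoad s lam + a * √s := by
    rw [sub_mul, slack_mul_sqrt hs]
    ring
  rw [isCohenSolution_iff hs, hload, slack_mul_sqrt hs, sub_sub_cancel, eq_div_iff hr.ne']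
  constructor
  · rintro ⟨ha, hC⟩
    have hpos : 0 < carriedLoad s lam + a * √s :=
      add_pos_of_pos_of_nonneg (carriedLoad_pos hs h) (mul_nonneg ha hr.le)
    linarith [(strictMonoOn_carriedLoad hs).injOn hpos h hC]
  · intro ha
    rw [ha, add_sub_cancel]
    exact ⟨nonneg_of_mul_nonneg_left (ha ▸ (sub_pos.2 (carriedLoad_lt_self s h)).le) hr, rfl⟩

theorem existsUnique_isCohenSolution (hs : 1 ≤ s) (hγ : γ ∈ Ioo 0 √(s : ℝ)) :
    ∃! a, IsCohenSolution s γ a := by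
  obtain ⟨lam, h, rfl⟩ := exists_slack_eq hγ
  simp only [isCohenSolution_slack_iff hs h]
  exact existsUnique_eq

theorem cohenSol_slack (hs : 1 ≤ s) (h : 0 < lam) :
    cohenSol s (slack s lam) = (lam - carriedLoad s lam) / √s :=
  (isCohenSolution_slack_iff hs h _).1
    (Classical.epsilon_spec ⟨_, (isCohenSolution_slack_iff hs h _).2 rfl⟩)

theorem carriedL_slack (hs : 1 ≤ s) (h : 0 < lam) :
    carriedL s (slack s lam) = carriedLoad s lam ^ 2 / lam / √s := by
  have hr := sqrt_natCast_pos hs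
  rw [carriedL, cohenSol_slack hs h, sqrt_sub_slack, ← add_div, add_sub_cancel]
  field_simp

theorem carriedL_mem_Ioo (hs : 1 ≤ s) (hγ : γ ∈ Ioo 0 √(s : ℝ)) :
    carriedL s γ ∈ Ioo 0 (√s - γ) := by
  obtain ⟨lam, h, rfl⟩ := exists_slack_eq hγ
  have hr := sqrt_natCast_pos hs
  have hC := carriedLoad_pos hs h
  rw [carriedL_slack hs h, sqrt_sub_slack]
  refine ⟨by positivity, div_lt_div_of_pos_right ?_ hr⟩
  rw [div_lt_iff₀ h, sq]
  exact mul_lt_mul_of_pos_left (carriedLoad_lt_self s h) hC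

theorem abs_carriedLoad_sq_div_sub_le (hs : 1 ≤ s) (h : 0 < lam) :
    |carriedLoad s lam ^ 2 / lam - (s - carriedLoad s lam) * s| ≤
      2 * s * (s - carriedLoad s lam) ^ 2 := by
  have hs1 : (1 : ℝ) ≤ s := by exact_mod_cast hs
  have hC := carriedLoad_pos hs h
  have hT : 0 < s - carriedLoad s lam := sub_pos.2 (carriedLoad_lt hs h)
  have hupper : carriedLoad s lam / lam ≤ s - carriedLoad s lam :=
    (div_le_iff₀ h).2 (carriedLoad_le_sub_mul hs h)
  have hlower : (1 - carriedLoad s lam / lam) * (s - carriedLoad s lam) ≤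
      carriedLoad s lam / lam := by
    rw [le_div_iff₀ h]
    refine le_trans (le_of_eq ?_) (sub_mul_sub_carriedLoad_le s h)
    field_simp
  have hsplit : carriedLoad s lam ^ 2 / lam =
      (s - (s - carriedLoad s lam)) * (carriedLoad s lam / lam) := by
    rw [sub_sub_cancel, sq, mul_div_assoc]
  have hCT : carriedLoad s lam = s - (s - carriedLoad s lam) := (sub_sub_cancel _ _).symm
  rw [hsplit]
  rw [hCT] at hC
  generalize carriedLoad s lam / lam = p at *
  generalize (s : ℝ) - carriedLoad s lam = T at *
  rw [abs_le]
  constructor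
  · have : (s - T) * (T - T ^ 2) ≤ (s - T) * p := by
      gcongr
      nlinarith
    nlinarith [pow_pos hT 3, pow_pos hT 2]
  · have : (s - T) * p ≤ (s - T) * T := by gcongr
    nlinarith [pow_pos hT 2]

theorem abs_carriedL_sub_mul_le (hs : 1 ≤ s) (hγ : γ ∈ Ioo 0 √(s : ℝ)) :
    |carriedL s γ - γ * s| ≤ γ * s * (2 * (γ * √s)) := by
  obtain ⟨lam, h, rfl⟩ := exists_slack_eq hγ
  have hr := sqrt_natCast_pos hs
  have hdiff : carriedL s (slack s lam) - slack s lam * s =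
      (carriedLoad s lam ^ 2 / lam - (s - carriedLoad s lam) * s) / √s := by
    rw [carriedL_slack hs h, slack]
    ring
  have hbound : slack s lam * s * (2 * (slack s lam * √s)) =
      2 * s * (s - carriedLoad s lam) ^ 2 / √s := by
    rw [slack_mul_sqrt hs, slack]
    ring
  rw [hdiff, hbound, abs_div, abs_of_pos hr]
  exact div_le_div_of_nonneg_right (abs_carriedLoad_sq_div_sub_le hs h) hr.le

theorem sqrt_mul_pow_le_factorial_mul_exp (s : ℕ) :
    √s * (s : ℝ) ^ s ≤ s.factorial * Real.exp s := by
  have hexp : Real.exp (s : ℝ) = Real.exp 1 ^ s := by rw [← Real.exp_nat_mul, mul_one]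
  have hstirling := Stirling.le_factorial_stirling s
  rw [div_pow, mul_div_assoc', div_le_iff₀ (by positivity), ← hexp] at hstirling
  refine le_trans ?_ hstirling
  gcongr
  nlinarith [Real.pi_gt_three, s.cast_nonneg (α := ℝ)]

theorem pow_le_two_mul_carriedLoad_pow (hs : 1 ≤ s) (h : 0 < lam) (hlam : s * lam ≤ 1 / 2) :
    lam ^ s ≤ 2 * carriedLoad s lam ^ s := by
  have hs1 : (1 : ℝ) ≤ s := by exact_mod_cast hs
  have hB : s * erlangB s lam ≤ 1 / 2 :=
    (mul_le_mul_of_nonneg_left (erlangB_le_self hs h) (by positivity)).trans hlam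
  have hbernoulli : 1 / 2 ≤ (1 - erlangB s lam) ^ s := by
    have := one_add_mul_le_pow (a := -erlangB s lam) (by linarith [erlangB_le_one s h]) s
    rw [← sub_eq_add_neg] at this
    linarith
  rw [carriedLoad, mul_pow]
  nlinarith [pow_pos h s]

theorem erlangB_le_exp_div_sqrt_mul (hs : 1 ≤ s) (h : 0 < lam) (hlam : s * lam ≤ 1 / 2) :
    erlangB s lam ≤ 2 * (Real.exp s / √s * (carriedLoad s lam / s) ^ s) := by
  have hr := sqrt_natCast_pos hs
  have hC := carriedLoad_pos hs h
  refine (erlangB_le_pow_div_factorial s h).trans ?_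
  rw [div_pow, div_mul_div_comm, mul_div_assoc', div_le_div_iff₀ (by positivity) (by positivity)]
  calc lam ^ s * (√s * (s : ℝ) ^ s)
      ≤ (2 * carriedLoad s lam ^ s) * (s.factorial * Real.exp s) :=
        mul_le_mul (pow_le_two_mul_carriedLoad_pow hs h hlam)
          (sqrt_mul_pow_le_factorial_mul_exp s) (by positivity) (by positivity)
    _ = 2 * (Real.exp s * carriedLoad s lam ^ s) * s.factorial := by ring

theorem eventually_abs_carriedL_sub_le (hs : 1 ≤ s) :
    ∀ᶠ γ in 𝓝[<] √(s : ℝ), |carriedL s γ - (√s - γ)| ≤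
      (√s - γ) * (2 * (Real.exp s / √s * (1 - γ / √s) ^ s)) := by
  have hs0 : (0 : ℝ) < s := by exact_mod_cast hs
  have hq : (0 : ℝ) < 1 / (2 * s) := by positivity
  have hslack := slack_mem_Ioo hs hq
  filter_upwards [Ioo_mem_nhdsLT hslack.2] with γ hγ
  obtain ⟨lam, h, rfl⟩ := exists_slack_eq ⟨hslack.1.trans hγ.1, hγ.2⟩
  have hlam : s * lam ≤ 1 / 2 := by
    have hlt : lam < 1 / (2 * s) := ((strictAntiOn_slack hs).lt_iff_gt hq h).1 hγ.1
    rw [lt_div_iff₀ (by positivity)] at hlt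
    linarith
  have hC := carriedLoad_pos hs h
  have hB := erlangB_pos s h
  have hdiff : carriedLoad s lam ^ 2 / lam / √s - carriedLoad s lam / √s =
      -(carriedLoad s lam / √s * erlangB s lam) := by
    rw [← sub_div, sq, mul_div_assoc, carriedLoad]
    field_simp
    ring
  rw [carriedL_slack hs h, sqrt_sub_slack, one_sub_slack_div_sqrt hs, hdiff, abs_neg,
    abs_of_nonneg (by positivity)]
  gcongr
  exact erlangB_le_exp_div_sqrt_mul hs h hlam

/-- The maximizer of `carriedL s`, denoted `γ̂_s` in the paper. -/
noncomputable def optSlack (s : ℕ) : ℝ := slack s (optLoad s)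

theorem optSlack_mem_Ioo (hs : 1 ≤ s) : optSlack s ∈ Ioo 0 √(s : ℝ) :=
  slack_mem_Ioo hs (optLoad_pos hs)

theorem slack_lt_optSlack_iff (hs : 1 ≤ s) (h : 0 < lam) :
    slack s lam < optSlack s ↔ 0 < overloadGap s lam := by
  rw [overloadGap_pos_iff hs h, optSlack, (strictAntiOn_slack hs).lt_iff_gt h (optLoad_pos hs)]

theorem optSlack_lt_slack_iff (hs : 1 ≤ s) (h : 0 < lam) :
    optSlack s < slack s lam ↔ overloadGap s lam < 0 := by
  rw [overloadGap_neg_iff hs h, optSlack, (strictAntiOn_slack hs).lt_iff_gt (optLoad_pos hs) h]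

theorem slack_mul_cohenSol_eq_iff (hs : 1 ≤ s) (h : 0 < lam) :
    slack s lam * cohenSol s (slack s lam) = 1 / 2 * (1 - slack s lam / √s) ↔
      overloadGap s lam = 0 := by
  have hs0 : (s : ℝ) ≠ 0 := by positivity
  rw [one_sub_slack_div_sqrt hs, cohenSol_slack hs h, slack, div_mul_div_comm,
    Real.mul_self_sqrt s.cast_nonneg, mul_div_assoc', div_left_inj' hs0, overloadGap]
  constructor <;> intro h <;> linarith

theorem mul_cohenSol_eq_iff (hs : 1 ≤ s) (hγ : γ ∈ Ioo 0 √(s : ℝ)) :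
    γ * cohenSol s γ = 1 / 2 * (1 - γ / √s) ↔ γ = optSlack s := by
  obtain ⟨lam, h, rfl⟩ := exists_slack_eq hγ
  rw [slack_mul_cohenSol_eq_iff hs h, overloadGap_eq_zero_iff hs h, optSlack,
    (strictAntiOn_slack hs).injOn.eq_iff h (optLoad_pos hs)]

theorem strictMonoOn_carriedL (hs : 1 ≤ s) : StrictMonoOn (carriedL s) (Ioc 0 (optSlack s)) := by
  have hanti := strictAntiOn_slack hs
  have hopt := optSlack_mem_Ioo hs
  intro x hx y hy hxy
  obtain ⟨u, hu, rfl⟩ := exists_slack_eq ⟨hx.1, hx.2.trans_lt hopt.2⟩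
  obtain ⟨v, hv, rfl⟩ := exists_slack_eq ⟨hy.1, hy.2.trans_lt hopt.2⟩
  have hvu : v < u := (hanti.lt_iff_gt hu hv).1 hxy
  have hle : optLoad s ≤ v := (hanti.le_iff_ge hv (optLoad_pos hs)).1 hy.2
  rw [carriedL_slack hs hu, carriedL_slack hs hv]
  exact div_lt_div_of_pos_right
    (strictAntiOn_carriedLoad_sq_div hs hle (hle.trans hvu.le) hvu) (sqrt_natCast_pos hs)

theorem strictAntiOn_carriedL (hs : 1 ≤ s) :
    StrictAntiOn (carriedL s) (Ico (optSlack s) √s) := by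
  have hanti := strictAntiOn_slack hs
  have hopt := optSlack_mem_Ioo hs
  intro x hx y hy hxy
  obtain ⟨u, hu, rfl⟩ := exists_slack_eq ⟨hopt.1.trans_le hx.1, hx.2⟩
  obtain ⟨v, hv, rfl⟩ := exists_slack_eq ⟨hopt.1.trans_le hy.1, hy.2⟩
  have hvu : v < u := (hanti.lt_iff_gt hu hv).1 hxy
  have hle : u ≤ optLoad s := (hanti.le_iff_ge (optLoad_pos hs) hu).1 hx.1
  rw [carriedL_slack hs hu, carriedL_slack hs hv]
  exact div_lt_div_of_pos_right
    (strictMonoOn_carriedLoad_sq_div hs ⟨hv, hvu.le.trans hle⟩ ⟨hu, hle⟩ hvu)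
    (sqrt_natCast_pos hs)

theorem carriedL_lt_carriedL_optSlack (hs : 1 ≤ s) (hγ : γ ∈ Ioo 0 √(s : ℝ))
    (hne : γ ≠ optSlack s) : carriedL s γ < carriedL s (optSlack s) := by
  have hopt := optSlack_mem_Ioo hs
  rcases hne.lt_or_gt with hlt | hlt
  · exact strictMonoOn_carriedL hs ⟨hγ.1, hlt.le⟩ (right_mem_Ioc.2 hopt.1) hlt
  · exact strictAntiOn_carriedL hs (left_mem_Ico.2 hopt.2) ⟨hlt.le, hγ.2⟩ hlt

theorem carriedL_optSlack (hs : 1 ≤ s) :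
    carriedL s (optSlack s) =
      optSlack s / (optSlack s + 1 / (2 * √s)) * (√s - optSlack s) := by
  have hr := sqrt_natCast_pos hs
  have hopt := optSlack_mem_Ioo hs
  have hpos := hopt.1
  have hsub : 0 < √(s : ℝ) - optSlack s := sub_pos.2 hopt.2
  have hsol : cohenSol s (optSlack s) = (√s - optSlack s) / (2 * optSlack s * √s) := by
    have hroot := (mul_cohenSol_eq_iff hs hopt).2 rfl
    field_simp at hroot ⊢
    linarith
  rw [carriedL, hsol]
  field_simp

theorem lossF_zero_eq_slack (hs : 1 ≤ s) : lossF s 0 = slack s s := by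
  have hloss := lossF_mul_sqrt hs 0
  rw [zero_mul, sub_zero, ← slack_mul_sqrt hs] at hloss
  exact mul_right_cancel₀ (sqrt_natCast_pos hs).ne' hloss

theorem lossF_zero_lt_optSlack (hs : 2 ≤ s) : lossF s 0 < optSlack s := by
  have hs1 : 1 ≤ s := one_le_two.trans hs
  rw [lossF_zero_eq_slack hs1, slack_lt_optSlack_iff hs1 (by exact_mod_cast hs1)]
  exact overloadGap_self_pos hs

theorem lt_lossF_zero (hs : 2 ≤ s) :
    √(1 / 2 + 1 / (16 * (s : ℝ))) - 1 / (4 * √s) < lossF s 0 := by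
  have hs1 : 1 ≤ s := one_le_two.trans hs
  have hr := sqrt_natCast_pos hs1
  have hcast : √(s : ℝ) ^ 2 = s := Real.sq_sqrt s.cast_nonneg
  have hf : 0 < lossF s 0 :=
    lossF_zero_eq_slack hs1 ▸ (slack_mem_Ioo hs1 (by exact_mod_cast hs1)).1
  have hgap : 0 < 2 * lossF s 0 ^ 2 + lossF s 0 / √s - 1 := by
    have hC := lossF_zero_eq_slack hs1 ▸ slack_mul_sqrt hs1 s
    have hself := overloadGap_self_pos hs
    rw [overloadGap, ← hC, show carriedLoad s s = √s ^ 2 - lossF s 0 * √s by linarith] at hself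
    refine pos_of_mul_pos_left (b := √(s : ℝ) ^ 2) (hself.trans_eq ?_) (by positivity)
    field_simp
    ring
  have hsq : (lossF s 0 + 1 / (4 * √s)) ^ 2 - (1 / 2 + 1 / (16 * (s : ℝ))) =
      (2 * lossF s 0 ^ 2 + lossF s 0 / √s - 1) / 2 := by
    nth_rw 2 [← hcast]
    field_simp
    ring
  rw [sub_lt_iff_lt_add, Real.sqrt_lt' (by positivity)]
  linarith

end CohenEquation

section TiltedGaussian

open MeasureTheory

variable {ε ε₁ ε₂ δ δ₁ δ₂ y : ℝ}

/-- The exponent `∫₀^y u / (1 + ε u) du`, which interpolates between `y² / 2` at `ε = 0` and the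
exponent `s (x - log (1 + x))`, `x = y / √s`, of a Gamma density at `ε = 1 / √s`. The absolute
value only serves to make the integrand continuous on the whole plane. -/
noncomputable def tiltExponent (ε y : ℝ) : ℝ := ∫ u in (0 : ℝ)..y, u / (1 + |ε * u|)

/-- The derivative of `-tiltExponent` with respect to `ε`. -/
noncomputable def tiltRate (ε y : ℝ) : ℝ := ∫ u in (0 : ℝ)..y, (u / (1 + |ε * u|)) ^ 2

/-- The weight `exp (δ y - tiltExponent ε y)`; for `ε = 0` it is an exponentially tilted Gaussian
density. -/
noncomputable def tiltWeight (ε δ y : ℝ) : ℝ := Real.exp (δ * y - tiltExponent ε y)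

/-- The moments of `tiltWeight ε δ` on the half line. -/
noncomputable def tiltMoment (n : ℕ) (ε δ : ℝ) : ℝ :=
  ∫ y in Ioi (0 : ℝ), y ^ n * tiltWeight ε δ y

theorem continuous_div_one_add_abs :
    Continuous fun p : ℝ × ℝ => p.2 / (1 + |p.1 * p.2|) :=
  Continuous.div (by fun_prop) (by fun_prop) fun p => by positivity

theorem continuous_div_one_add_abs_right (ε : ℝ) : Continuous fun u : ℝ => u / (1 + |ε * u|) :=
  continuous_div_one_add_abs.comp (Continuous.prodMk_right ε)

theorem continuous_tiltExponent : Continuous fun p : ℝ × ℝ => tiltExponent p.1 p.2 :=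
  intervalIntegral.continuous_parametric_primitive_of_continuous
    (f := fun ε u : ℝ => u / (1 + |ε * u|)) (a₀ := 0) continuous_div_one_add_abs

theorem continuous_tiltRate (ε : ℝ) : Continuous (tiltRate ε) :=
  intervalIntegral.continuous_primitive
    (fun _ _ => ((continuous_div_one_add_abs_right ε).pow 2).intervalIntegrable _ _) 0

theorem continuous_tiltWeight (ε δ : ℝ) : Continuous (tiltWeight ε δ) := by
  have : Continuous (tiltExponent ε) := continuous_tiltExponent.comp (Continuous.prodMk_right ε)
  unfold tiltWeight
  fun_prop

theorem tiltExponent_zero_right (ε : ℝ) : tiltExponent ε 0 = 0 :=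
  intervalIntegral.integral_same

theorem tiltWeight_pos (ε δ y : ℝ) : 0 < tiltWeight ε δ y := Real.exp_pos _

theorem tiltWeight_zero_right (ε δ : ℝ) : tiltWeight ε δ 0 = 1 := by
  rw [tiltWeight, tiltExponent_zero_right, mul_zero, sub_zero, Real.exp_zero]

theorem tiltExponent_eq (hε : 0 < ε) (hy : 0 ≤ y) :
    tiltExponent ε y = y / ε - Real.log (1 + ε * y) / ε ^ 2 := by
  have hderiv : ∀ u ∈ uIcc 0 y, HasDerivAt (fun u => u / ε - Real.log (1 + ε * u) / ε ^ 2)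
      (u / (1 + |ε * u|)) u := by
    intro u hu
    rw [uIcc_of_le hy] at hu
    have hu₀ : 0 ≤ ε * u := mul_nonneg hε.le hu.1
    have hlog := (((hasDerivAt_id u).const_mul ε).const_add 1).log (by positivity)
    refine (((hasDerivAt_id u).div_const ε).sub (hlog.div_const (ε ^ 2))).congr_deriv ?_
    rw [abs_of_nonneg hu₀, id]
    field_simp
    ring
  rw [tiltExponent, intervalIntegral.integral_eq_sub_of_hasDerivAt hderiv
    ((continuous_div_one_add_abs_right ε).intervalIntegrable 0 y)]
  simp only [zero_div, mul_zero, add_zero, Real.log_one, sub_zero]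

theorem tiltExponent_nonneg (ε : ℝ) (hy : 0 ≤ y) : 0 ≤ tiltExponent ε y :=
  intervalIntegral.integral_nonneg hy fun u hu => div_nonneg hu.1 (by positivity)

theorem tiltExponent_anti (h₁ : 0 ≤ ε₁) (h₁₂ : ε₁ ≤ ε₂) (hy : 0 ≤ y) :
    tiltExponent ε₂ y ≤ tiltExponent ε₁ y := by
  refine intervalIntegral.integral_mono_on hy
    ((continuous_div_one_add_abs_right ε₂).intervalIntegrable 0 y)
    ((continuous_div_one_add_abs_right ε₁).intervalIntegrable 0 y) fun u hu => ?_
  have hu₀ : 0 ≤ u := hu.1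
  rw [abs_of_nonneg (mul_nonneg h₁ hu₀), abs_of_nonneg (mul_nonneg (h₁.trans h₁₂) hu₀)]
  gcongr

theorem hasDerivAt_tiltExponent (hε : 0 ≤ ε) (hy : 0 ≤ y) :
    HasDerivAt (tiltExponent ε) (y / (1 + ε * y)) y := by
  have hc := continuous_div_one_add_abs_right ε
  have h := intervalIntegral.integral_hasDerivAt_right (hc.intervalIntegrable 0 y)
    (hc.stronglyMeasurableAtFilter _ _) hc.continuousAt
  rwa [abs_of_nonneg (by positivity)] at h

theorem hasDerivAt_tiltWeight (δ : ℝ) (hε : 0 ≤ ε) (hy : 0 ≤ y) :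
    HasDerivAt (tiltWeight ε δ) (tiltWeight ε δ y * (δ - y / (1 + ε * y))) y := by
  have h := (((hasDerivAt_id y).const_mul δ).sub (hasDerivAt_tiltExponent hε hy)).exp
  rwa [mul_one] at h

theorem tiltWeight_mono (h₁ : 0 ≤ ε₁) (hε : ε₁ ≤ ε₂) (hδ : δ₁ ≤ δ₂) (hy : 0 ≤ y) :
    tiltWeight ε₁ δ₁ y ≤ tiltWeight ε₂ δ₂ y :=
  Real.exp_le_exp.2 (sub_le_sub (mul_le_mul_of_nonneg_right hδ hy) (tiltExponent_anti h₁ hε hy))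

theorem div_mul_sub_le_tiltExponent {y₀ : ℝ} (hε : 0 ≤ ε) (hy₀ : 0 ≤ y₀) (hy : 0 ≤ y) :
    y₀ / (1 + ε * y₀) * (y - y₀) ≤ tiltExponent ε y := by
  have hinteg := fun a b =>
    (continuous_div_one_add_abs_right ε).intervalIntegrable (μ := volume) a b
  rcases le_total y y₀ with hle | hle
  · exact (mul_nonpos_of_nonneg_of_nonpos (by positivity) (sub_nonpos.2 hle)).trans
      (tiltExponent_nonneg ε hy)
  · calc y₀ / (1 + ε * y₀) * (y - y₀) = ∫ _ in y₀..y, y₀ / (1 + ε * y₀) := by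
          rw [intervalIntegral.integral_const, smul_eq_mul, mul_comm]
      _ ≤ ∫ u in y₀..y, u / (1 + |ε * u|) := by
          refine intervalIntegral.integral_mono_on hle intervalIntegrable_const (hinteg y₀ y)
            fun u hu => ?_
          have hu₀ : 0 ≤ u := hy₀.trans hu.1
          rw [abs_of_nonneg (by positivity), div_le_div_iff₀ (by positivity) (by positivity)]
          linarith [hu.1]
      _ ≤ tiltExponent ε y₀ + ∫ u in y₀..y, u / (1 + |ε * u|) :=
          le_add_of_nonneg_left (tiltExponent_nonneg ε hy₀)
      _ = tiltExponent ε y :=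
          intervalIntegral.integral_add_adjacent_intervals (hinteg 0 y₀) (hinteg y₀ y)

theorem exists_tiltWeight_le_exp (hε : 0 ≤ ε) (h : δ * ε < 1) :
    ∃ κ > 0, ∃ C, ∀ y, 0 ≤ y → tiltWeight ε δ y ≤ C * Real.exp (-κ * y) := by
  have hk : 0 < 1 - δ * ε := sub_pos.2 h
  -- The slope `y₀ / (1 + ε y₀)` of the exponent tends to `1 / ε > δ`.
  set y₀ := (|δ| + 1) / (1 - δ * ε)
  have hy₀_pos : 0 < y₀ := by positivity
  have hslope : δ < y₀ / (1 + ε * y₀) := by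
    rw [lt_div_iff₀ (by positivity)]
    have : y₀ * (1 - δ * ε) = |δ| + 1 := div_mul_cancel₀ _ hk.ne'
    linarith [le_abs_self δ]
  refine ⟨y₀ / (1 + ε * y₀) - δ, sub_pos.2 hslope, Real.exp (y₀ / (1 + ε * y₀) * y₀),
    fun y hy => ?_⟩
  rw [← Real.exp_add]
  refine Real.exp_le_exp.2 ?_
  linarith [div_mul_sub_le_tiltExponent hε hy₀_pos.le hy]

theorem integrableOn_pow_mul_exp_neg_mul (n : ℕ) {κ : ℝ} (hκ : 0 < κ) :
    IntegrableOn (fun y : ℝ => y ^ n * Real.exp (-κ * y)) (Ioi 0) := by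
  have hn : (-1 : ℝ) < n := neg_one_lt_zero.trans_le n.cast_nonneg
  simpa only [Real.rpow_natCast, Real.rpow_one] using
    integrableOn_rpow_mul_exp_neg_mul_rpow hn one_pos hκ

theorem integrableOn_pow_mul_tiltWeight (n : ℕ) (hε : 0 ≤ ε) (h : δ * ε < 1) :
    IntegrableOn (fun y : ℝ => y ^ n * tiltWeight ε δ y) (Ioi 0) := by
  obtain ⟨κ, hκ, C, hC⟩ := exists_tiltWeight_le_exp hε h
  refine Integrable.mono' ((integrableOn_pow_mul_exp_neg_mul n hκ).const_mul C)
    ((continuous_pow n).mul (continuous_tiltWeight ε δ)).aestronglyMeasurable ?_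
  filter_upwards [ae_restrict_mem measurableSet_Ioi] with y (hy : 0 < y)
  have hw := tiltWeight_pos ε δ y
  rw [Real.norm_of_nonneg (by positivity), mul_left_comm]
  exact mul_le_mul_of_nonneg_left (hC y hy.le) (by positivity)

theorem tendsto_pow_mul_tiltWeight (n : ℕ) (hε : 0 ≤ ε) (h : δ * ε < 1) :
    Tendsto (fun y : ℝ => y ^ n * tiltWeight ε δ y) atTop (𝓝 0) := by
  obtain ⟨κ, hκ, C, hC⟩ := exists_tiltWeight_le_exp hε h
  have hlim : Tendsto (fun y : ℝ => C / κ ^ n * ((κ * y) ^ n * Real.exp (-(κ * y)))) atTop (𝓝 0) :=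
    mul_zero (C / κ ^ n) ▸ ((Real.tendsto_pow_mul_exp_neg_atTop_nhds_zero n).comp
      (tendsto_id.const_mul_atTop hκ)).const_mul (C / κ ^ n)
  refine squeeze_zero' ?_ ?_ hlim
  · filter_upwards [eventually_ge_atTop 0] with y hy
    exact mul_nonneg (pow_nonneg hy n) (tiltWeight_pos ε δ y).le
  · filter_upwards [eventually_ge_atTop 0] with y hy
    calc y ^ n * tiltWeight ε δ y ≤ y ^ n * (C * Real.exp (-κ * y)) :=
          mul_le_mul_of_nonneg_left (hC y hy) (pow_nonneg hy n)
      _ = C / κ ^ n * ((κ * y) ^ n * Real.exp (-(κ * y))) := by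
          rw [mul_pow, neg_mul]
          field_simp

theorem tiltMoment_pos (n : ℕ) (hε : 0 ≤ ε) (h : δ * ε < 1) : 0 < tiltMoment n ε δ := by
  have hpos : ∀ y ∈ Ioi (0 : ℝ), 0 < y ^ n * tiltWeight ε δ y := fun y hy =>
    mul_pos (pow_pos hy n) (tiltWeight_pos ε δ y)
  refine (setIntegral_pos_iff_support_of_nonneg_ae ?_
    (integrableOn_pow_mul_tiltWeight n hε h)).2 ?_
  · filter_upwards [ae_restrict_mem measurableSet_Ioi] with y hy using (hpos y hy).le
  · have hsub : Ioi (0 : ℝ) ⊆ Function.support fun y => y ^ n * tiltWeight ε δ y :=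
      fun y hy => (hpos y hy).ne'
    rw [inter_eq_self_of_subset_right hsub, Real.volume_Ioi]
    exact ENNReal.zero_lt_top

theorem integrableOn_trinomial_mul_tiltWeight (a b c : ℝ) (k m n : ℕ) (hε : 0 ≤ ε)
    (h : δ * ε < 1) :
    IntegrableOn (fun y : ℝ => (a * y ^ k + b * y ^ m + c * y ^ n) * tiltWeight ε δ y)
      (Ioi 0) := by
  have hinteg := fun n => integrableOn_pow_mul_tiltWeight n hε h
  simp only [add_mul, mul_assoc]
  exact (((hinteg k).const_mul a).add ((hinteg m).const_mul b)).add ((hinteg n).const_mul c)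

theorem integral_trinomial_mul_tiltWeight (a b c : ℝ) (k m n : ℕ) (hε : 0 ≤ ε)
    (h : δ * ε < 1) :
    ∫ y in Ioi (0 : ℝ), (a * y ^ k + b * y ^ m + c * y ^ n) * tiltWeight ε δ y =
      a * tiltMoment k ε δ + b * tiltMoment m ε δ + c * tiltMoment n ε δ := by
  have hinteg := fun n => integrableOn_pow_mul_tiltWeight n hε h
  have hsum : IntegrableOn
      (fun y : ℝ => a * (y ^ k * tiltWeight ε δ y) + b * (y ^ m * tiltWeight ε δ y)) (Ioi 0) :=
    ((hinteg k).const_mul a).add ((hinteg m).const_mul b)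
  simp only [add_mul, mul_assoc, tiltMoment]
  rw [integral_add hsum ((hinteg n).const_mul c),
    integral_add ((hinteg k).const_mul a) ((hinteg m).const_mul b), integral_const_mul,
    integral_const_mul, integral_const_mul]

theorem tiltMoment_succ (m : ℕ) (hε : 0 ≤ ε) (h : δ * ε < 1) :
    (1 - δ * ε) * tiltMoment (m + 1) ε δ =
      0 ^ m + (δ + (m + 1) * ε) * tiltMoment m ε δ + m * tiltMoment (m - 1) ε δ := by
  -- The factor `1 + ε y` cancels the denominator in `w' = (δ - y / (1 + ε y)) w`.
  have hderiv : ∀ y ∈ Ici (0 : ℝ), HasDerivAt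
      (fun y => y ^ m * tiltWeight ε δ y + ε * (y ^ (m + 1) * tiltWeight ε δ y))
      ((m * y ^ (m - 1) + (δ + (m + 1) * ε) * y ^ m + -(1 - δ * ε) * y ^ (m + 1)) *
        tiltWeight ε δ y) y := by
    intro y (hy : 0 ≤ y)
    have hw := hasDerivAt_tiltWeight δ hε hy
    refine (((hasDerivAt_pow m y).mul hw).add
      (((hasDerivAt_pow (m + 1) y).mul hw).const_mul ε)).congr_deriv ?_
    have : 1 + ε * y ≠ 0 := by positivity
    push_cast [add_tsub_cancel_right]
    field_simp
    ring
  have hlim := (tendsto_pow_mul_tiltWeight m hε h).add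
    ((tendsto_pow_mul_tiltWeight (m + 1) hε h).const_mul ε)
  rw [mul_zero, add_zero] at hlim
  have key := integral_Ioi_of_hasDerivAt_of_tendsto' hderiv
    (integrableOn_trinomial_mul_tiltWeight _ _ _ _ _ _ hε h) hlim
  rw [integral_trinomial_mul_tiltWeight _ _ _ _ _ _ hε h, tiltWeight_zero_right,
    zero_pow m.succ_ne_zero] at key
  linarith

theorem exists_pos_add_mul_add_lt_one (h : δ * ε < 1) : ∃ η > 0, (δ + η) * (ε + η) < 1 := by
  have hc : ContinuousAt (fun η : ℝ => (δ + η) * (ε + η)) 0 := by fun_prop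
  have hev : ∀ᶠ η in 𝓝[>] (0 : ℝ), (δ + η) * (ε + η) < 1 :=
    (hc.eventually (gt_mem_nhds (by simpa only [add_zero] using h))).filter_mono
      nhdsWithin_le_nhds
  obtain ⟨η, hη, hη₀⟩ := (hev.and self_mem_nhdsWithin).exists
  exact ⟨η, hη₀, hη⟩

theorem tendsto_tiltMoment {ι : Type*} {l : Filter ι} [l.IsCountablyGenerated] (n : ℕ)
    {e d : ι → ℝ} (hε : 0 ≤ ε) (h : δ * ε < 1) (he : Tendsto e l (𝓝 ε))
    (hd : Tendsto d l (𝓝 δ)) (he₀ : ∀ᶠ t in l, 0 ≤ e t) :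
    Tendsto (fun t => tiltMoment n (e t) (d t)) l (𝓝 (tiltMoment n ε δ)) := by
  obtain ⟨η, hη, hη₁⟩ := exists_pos_add_mul_add_lt_one h
  refine tendsto_integral_filter_of_dominated_convergence
    (fun y => y ^ n * tiltWeight (ε + η) (δ + η) y) ?_ ?_
    (integrableOn_pow_mul_tiltWeight n (by positivity) hη₁) ?_
  · exact .of_forall fun t =>
      ((continuous_pow n).mul (continuous_tiltWeight _ _)).aestronglyMeasurable
  · filter_upwards [he₀, he.eventually (gt_mem_nhds (lt_add_of_pos_right ε hη)),
      hd.eventually (gt_mem_nhds (lt_add_of_pos_right δ hη))] with t h₀ h₁ h₂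
    filter_upwards [ae_restrict_mem measurableSet_Ioi] with y (hy : 0 < y)
    have hw := tiltWeight_pos (e t) (d t) y
    rw [Real.norm_of_nonneg (by positivity)]
    exact mul_le_mul_of_nonneg_left (tiltWeight_mono h₀ h₁.le h₂.le hy.le) (by positivity)
  · refine .of_forall fun y => ?_
    have hexp : Tendsto (fun t => tiltExponent (e t) y) l (𝓝 (tiltExponent ε y)) :=
      ((continuous_tiltExponent.comp (Continuous.prodMk_left y)).tendsto ε).comp he
    exact (((hd.mul_const y).sub hexp).rexp).const_mul _

theorem tiltRate_nonneg (ε : ℝ) (hy : 0 ≤ y) : 0 ≤ tiltRate ε y :=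
  intervalIntegral.integral_nonneg hy fun _ _ => sq_nonneg _

theorem tiltRate_le (ε : ℝ) (hy : 0 ≤ y) : tiltRate ε y ≤ y ^ 3 := by
  have hbound : ∀ u ∈ Icc 0 y, (u / (1 + |ε * u|)) ^ 2 ≤ y ^ 2 := fun u hu => by
    have hu₀ : 0 ≤ u := hu.1
    have h₁ : 1 ≤ 1 + |ε * u| := le_add_of_nonneg_right (abs_nonneg _)
    exact pow_le_pow_left₀ (by positivity) ((div_le_self hu₀ h₁).trans hu.2) 2
  calc tiltRate ε y ≤ ∫ _ in (0 : ℝ)..y, y ^ 2 :=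
        intervalIntegral.integral_mono_on hy
          (((continuous_div_one_add_abs_right ε).pow 2).intervalIntegrable 0 y)
          intervalIntegrable_const hbound
    _ = y ^ 3 := by
        rw [intervalIntegral.integral_const, smul_eq_mul]
        ring

theorem le_tiltRate (c : ℝ) (hε : 0 ≤ ε) (hy : 0 ≤ y) :
    c * y ^ 2 - c ^ 2 * (y + ε * y ^ 2 + ε ^ 2 / 3 * y ^ 3) ≤ tiltRate ε y := by
  have hprim : ∀ u ∈ uIcc 0 y, HasDerivAt
      (fun u => c * u ^ 2 - c ^ 2 * (u + ε * u ^ 2 + ε ^ 2 / 3 * u ^ 3))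
      (2 * c * u - c ^ 2 * (1 + ε * u) ^ 2) u := fun u _ => by
    refine (((hasDerivAt_pow 2 u).const_mul c).sub ((((hasDerivAt_id u).add
      ((hasDerivAt_pow 2 u).const_mul ε)).add
        ((hasDerivAt_pow 3 u).const_mul (ε ^ 2 / 3))).const_mul (c ^ 2))).congr_deriv ?_
    norm_num
    ring
  have hcont : Continuous fun u : ℝ => 2 * c * u - c ^ 2 * (1 + ε * u) ^ 2 := by fun_prop
  have heq := intervalIntegral.integral_eq_sub_of_hasDerivAt hprim (hcont.intervalIntegrable 0 y)
  refine le_trans (le_of_eq ?_) (intervalIntegral.integral_mono_on hy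
    (hcont.intervalIntegrable 0 y)
    (((continuous_div_one_add_abs_right ε).pow 2).intervalIntegrable 0 y) fun u hu => ?_)
  · rw [heq]
    ring
  · have hq : 0 < 1 + ε * u := by have := hu.1; positivity
    rw [abs_of_nonneg (mul_nonneg hε hu.1)]
    have hcross : u / (1 + ε * u) * (c * (1 + ε * u)) = c * u := by
      rw [mul_left_comm, div_mul_cancel₀ _ hq.ne']
    linarith [sq_nonneg (u / (1 + ε * u) - c * (1 + ε * u))]

theorem hasDerivAt_tiltExponent_left (hε : 0 < ε) (hy : 0 ≤ y) :
    HasDerivAt (fun t => tiltExponent t y) (-tiltRate ε y) ε := by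
  have hderiv : ∀ u ∈ uIoc 0 y, ∀ t ∈ Ioi (0 : ℝ),
      HasDerivAt (fun t => u / (1 + |t * u|)) (-(u / (1 + |t * u|)) ^ 2) t := by
    intro u hu t (ht : 0 < t)
    rw [uIoc_of_le hy] at hu
    have hu₀ : 0 < u := hu.1
    have hlocal : (fun t => u / (1 + |t * u|)) =ᶠ[𝓝 t] fun t => u / (1 + t * u) := by
      filter_upwards [lt_mem_nhds ht] with t' ht'
      rw [abs_of_pos (mul_pos ht' hu₀)]
    refine HasDerivAt.congr_of_eventuallyEq ?_ hlocal
    refine ((hasDerivAt_const t u).div (((hasDerivAt_id t).mul_const u).const_add 1)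
      (by simp only [id]; positivity)).congr_deriv ?_
    rw [abs_of_pos (mul_pos ht hu₀), id, div_pow]
    ring
  have hbound : ∀ u ∈ uIoc 0 y, ∀ t ∈ Ioi (0 : ℝ), ‖-(u / (1 + |t * u|)) ^ 2‖ ≤ u ^ 2 := by
    intro u hu t _
    rw [uIoc_of_le hy] at hu
    rw [norm_neg, norm_pow, Real.norm_of_nonneg (div_nonneg hu.1.le (by positivity))]
    exact pow_le_pow_left₀ (div_nonneg hu.1.le (by positivity))
      (div_le_self hu.1.le (le_add_of_nonneg_right (abs_nonneg _))) 2
  have hcont := continuous_div_one_add_abs_right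
  have h := (intervalIntegral.hasDerivAt_integral_of_dominated_loc_of_deriv_le (Ioi_mem_nhds hε)
    (.of_forall fun t => (hcont t).aestronglyMeasurable) ((hcont ε).intervalIntegrable 0 y)
    ((hcont ε).pow 2).neg.aestronglyMeasurable (.of_forall hbound)
    ((continuous_pow 2).intervalIntegrable (μ := volume) 0 y) (.of_forall hderiv)).2
  rwa [intervalIntegral.integral_neg] at h

theorem integrableOn_tiltRate_mul_tiltWeight (hε : 0 ≤ ε) (h : δ * ε < 1) :
    IntegrableOn (fun y : ℝ => tiltRate ε y * tiltWeight ε δ y) (Ioi 0) := by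
  refine Integrable.mono' (integrableOn_pow_mul_tiltWeight 3 hε h)
    ((continuous_tiltRate ε).mul (continuous_tiltWeight ε δ)).aestronglyMeasurable ?_
  filter_upwards [ae_restrict_mem measurableSet_Ioi] with y (hy : 0 < y)
  have hw := (tiltWeight_pos ε δ y).le
  rw [Real.norm_of_nonneg (mul_nonneg (tiltRate_nonneg ε hy.le) hw)]
  exact mul_le_mul_of_nonneg_right (tiltRate_le ε hy.le) hw

theorem hasDerivAt_tiltWeight_path (δ₀ d : ℝ) (hε : 0 < ε) (hy : 0 ≤ y) :
    HasDerivAt (fun t => tiltWeight t (δ₀ + d * t) y)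
      ((d * y + tiltRate ε y) * tiltWeight ε (δ₀ + d * ε) y) ε := by
  have hlin := (((hasDerivAt_id ε).const_mul d).const_add δ₀).mul_const y
  refine (hlin.sub (hasDerivAt_tiltExponent_left hε hy)).exp.congr_deriv ?_
  rw [tiltWeight, mul_one, sub_neg_eq_add, mul_comm]
  rfl

theorem norm_deriv_tiltWeight_path_le (d : ℝ) (h₁ : 0 ≤ ε₁) (hε : ε₁ ≤ ε₂) (hδ : δ₁ ≤ δ₂)
    (hy : 0 ≤ y) :
    ‖(d * y + tiltRate ε₁ y) * tiltWeight ε₁ δ₁ y‖ ≤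
      (0 * y ^ 0 + |d| * y ^ 1 + 1 * y ^ 3) * tiltWeight ε₂ δ₂ y := by
  rw [norm_mul, Real.norm_of_nonneg (tiltWeight_pos _ _ _).le]
  refine mul_le_mul ?_ (tiltWeight_mono h₁ hε hδ hy) (tiltWeight_pos _ _ _).le (by positivity)
  calc ‖d * y + tiltRate ε₁ y‖ ≤ ‖d * y‖ + ‖tiltRate ε₁ y‖ := norm_add_le _ _
    _ = |d| * y + tiltRate ε₁ y := by
        rw [norm_mul, Real.norm_of_nonneg hy, Real.norm_eq_abs,
          Real.norm_of_nonneg (tiltRate_nonneg ε₁ hy)]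
    _ ≤ 0 * y ^ 0 + |d| * y ^ 1 + 1 * y ^ 3 := by linarith [tiltRate_le ε₁ hy]

theorem hasDerivAt_tiltMoment_zero_path {δ₀ d : ℝ} (hε : 0 < ε) (h : (δ₀ + d * ε) * ε < 1) :
    HasDerivAt (fun t => tiltMoment 0 t (δ₀ + d * t))
      (d * tiltMoment 1 ε (δ₀ + d * ε) +
        ∫ y in Ioi (0 : ℝ), tiltRate ε y * tiltWeight ε (δ₀ + d * ε) y) ε := by
  obtain ⟨η, hη, hη₁⟩ := exists_pos_add_mul_add_lt_one h
  set U := {t | 0 < t ∧ t < ε + η ∧ δ₀ + d * t < δ₀ + d * ε + η}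
  have hU : U ∈ 𝓝 ε := by
    have hc : ContinuousAt (fun t => δ₀ + d * t) ε := by fun_prop
    exact (lt_mem_nhds hε).and ((gt_mem_nhds (lt_add_of_pos_right ε hη)).and
      (hc.eventually (gt_mem_nhds (lt_add_of_pos_right _ hη))))
  have hcont := fun t δ => continuous_tiltWeight t δ
  have hinteg₀ : IntegrableOn (tiltWeight ε (δ₀ + d * ε)) (Ioi 0) := by
    simpa only [pow_zero, one_mul] using integrableOn_pow_mul_tiltWeight 0 hε.le h
  have hderiv := (hasDerivAt_integral_of_dominated_loc_of_deriv_le (μ := volume.restrict (Ioi 0)) hU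
    (.of_forall fun t => (hcont t (δ₀ + d * t)).aestronglyMeasurable)
    hinteg₀
    ((((continuous_const.mul continuous_id).add (continuous_tiltRate ε)).mul
      (hcont ε (δ₀ + d * ε))).aestronglyMeasurable)
    (by filter_upwards [ae_restrict_mem measurableSet_Ioi] with y (hy : 0 < y) t ht using
      norm_deriv_tiltWeight_path_le d ht.1.le ht.2.1.le ht.2.2.le hy.le)
    (integrableOn_trinomial_mul_tiltWeight 0 |d| 1 0 1 3 (by positivity) hη₁)
    (by filter_upwards [ae_restrict_mem measurableSet_Ioi] with y (hy : 0 < y) t ht using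
      hasDerivAt_tiltWeight_path δ₀ d ht.1 hy.le)).2
  simp only [add_mul, mul_assoc] at hderiv
  rw [integral_add ?_ (integrableOn_tiltRate_mul_tiltWeight hε.le h), integral_const_mul] at hderiv
  · simpa only [tiltMoment, pow_zero, one_mul, pow_one] using hderiv
  · simpa only [pow_one] using (integrableOn_pow_mul_tiltWeight 1 hε.le h).const_mul d

/-- Cauchy–Schwarz for `y² = 2 ∫₀^y (u / (1 + ε u)) (1 + ε u) du` with respect to
`w(y) 1_{u ≤ y} du dy`. -/
theorem sq_tiltMoment_two_le (hε : 0 ≤ ε) (h : δ * ε < 1) :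
    tiltMoment 2 ε δ ^ 2 ≤ 4 * (∫ y in Ioi (0 : ℝ), tiltRate ε y * tiltWeight ε δ y) *
      (tiltMoment 1 ε δ + ε * tiltMoment 2 ε δ + ε ^ 2 / 3 * tiltMoment 3 ε δ) := by
  set Q := tiltMoment 1 ε δ + ε * tiltMoment 2 ε δ + ε ^ 2 / 3 * tiltMoment 3 ε δ
  set I := ∫ y in Ioi (0 : ℝ), tiltRate ε y * tiltWeight ε δ y
  have hquad : ∀ c, c * tiltMoment 2 ε δ - c ^ 2 * Q ≤ I := fun c => by
    have hle := setIntegral_mono_on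
      (integrableOn_trinomial_mul_tiltWeight (-c ^ 2) (c - c ^ 2 * ε) (-(c ^ 2 * (ε ^ 2 / 3)))
        1 2 3 hε h)
      (integrableOn_tiltRate_mul_tiltWeight hε h) measurableSet_Ioi fun y (hy : 0 < y) =>
        mul_le_mul_of_nonneg_right
          (le_of_eq_of_le (by ring) (le_tiltRate c hε hy.le)) (tiltWeight_pos ε δ y).le
    rw [integral_trinomial_mul_tiltWeight _ _ _ _ _ _ hε h] at hle
    exact le_of_eq_of_le (by ring) hle
  have hdisc := discrim_le_zero (a := Q) (b := -tiltMoment 2 ε δ) (c := I)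
    fun c => by linarith [hquad c]
  rw [discrim] at hdisc
  linarith

end TiltedGaussian

section ErlangMass

open MeasureTheory

variable {s : ℕ} {lam δ : ℝ}

theorem inv_erlangB_eq_sum (s : ℕ) (h : lam ≠ 0) :
    (erlangB s lam)⁻¹ = ∑ k ∈ Finset.range (s + 1), (s.descFactorial k : ℝ) / lam ^ k := by
  rw [erlangB, inv_div, Finset.sum_div, ← Finset.sum_range_reflect]
  refine Finset.sum_congr rfl fun k hk => ?_
  have hk : k ≤ s := Nat.lt_succ_iff.1 (Finset.mem_range.1 hk)
  have hfact : ((s - k).factorial : ℝ) * s.descFactorial k = s.factorial := by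
    exact_mod_cast Nat.factorial_mul_descFactorial hk
  have hpow : lam ^ (s - k) * lam ^ k = lam ^ s := by rw [← pow_add, Nat.sub_add_cancel hk]
  rw [Nat.add_sub_cancel, ← hpow, ← hfact]
  field_simp

theorem tiltWeight_inv_sqrt (hs : 1 ≤ s) (δ : ℝ) {y : ℝ} (hy : 0 ≤ y) :
    tiltWeight (1 / √s) δ y =
      ∑ k ∈ Finset.range (s + 1), s.choose k / √s ^ k * (y ^ k * Real.exp (-(√s - δ) * y)) := by
  have hr := sqrt_natCast_pos hs
  have hcast : √(s : ℝ) ^ 2 = s := Real.sq_sqrt s.cast_nonneg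
  have hpos : 0 < y / √s + 1 := by positivity
  have hexp : δ * y - tiltExponent (1 / √s) y =
      Real.log ((y / √s + 1) ^ s) + -(√s - δ) * y := by
    rw [tiltExponent_eq (by positivity) hy, Real.log_pow, one_div_mul_eq_div, add_comm 1, div_pow,
      hcast]
    field_simp
    ring
  rw [tiltWeight, hexp, Real.exp_add, Real.exp_log (by positivity), add_pow, Finset.sum_mul]
  refine Finset.sum_congr rfl fun k _ => ?_
  rw [one_pow, div_pow]
  ring

theorem integral_pow_mul_exp_neg_mul (k : ℕ) {κ : ℝ} (hκ : 0 < κ) :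
    ∫ y in Ioi (0 : ℝ), y ^ k * Real.exp (-κ * y) = k.factorial / κ ^ (k + 1) := by
  have hGamma := Real.integral_rpow_mul_exp_neg_mul_Ioi (a := k + 1) (r := κ) (by positivity) hκ
  rw [Real.Gamma_nat_eq_factorial, add_sub_cancel_right] at hGamma
  simp only [Real.rpow_natCast, ← neg_mul] at hGamma
  rw [hGamma, ← Nat.cast_succ, Real.rpow_natCast, one_div, inv_pow, div_eq_mul_inv, mul_comm]

theorem tiltMoment_zero_inv_sqrt (hs : 1 ≤ s) (hδ : δ < √s) :
    tiltMoment 0 (1 / √s) δ = ((√s - δ) * erlangB s ((√s - δ) * √s))⁻¹ := by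
  have hr := sqrt_natCast_pos hs
  have hκ : 0 < √(s : ℝ) - δ := sub_pos.2 hδ
  calc tiltMoment 0 (1 / √s) δ
      = ∫ y in Ioi (0 : ℝ), ∑ k ∈ Finset.range (s + 1),
          s.choose k / √s ^ k * (y ^ k * Real.exp (-(√s - δ) * y)) :=
        setIntegral_congr_fun measurableSet_Ioi fun y (hy : 0 < y) => by
          rw [← tiltWeight_inv_sqrt hs δ hy.le, pow_zero, one_mul]
    _ = ∑ k ∈ Finset.range (s + 1), s.choose k / √s ^ k * (k.factorial / (√s - δ) ^ (k + 1)) := by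
        rw [integral_finsetSum _ fun k _ => (integrableOn_pow_mul_exp_neg_mul k hκ).const_mul _]
        simp only [integral_const_mul, integral_pow_mul_exp_neg_mul _ hκ]
    _ = ((√s - δ) * erlangB s ((√s - δ) * √s))⁻¹ := by
        rw [mul_inv, inv_erlangB_eq_sum s (mul_pos hκ hr).ne', Finset.mul_sum]
        refine Finset.sum_congr rfl fun k _ => ?_
        rw [Nat.descFactorial_eq_factorial_mul_choose, Nat.cast_mul, mul_pow, pow_succ]
        field_simp

theorem slack_sqrt_sub_mul_sqrt (hs : 1 ≤ s) (hδ : δ < √s) :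
    slack s ((√s - δ) * √s) = δ + (tiltMoment 0 (1 / √s) δ)⁻¹ := by
  have hr := sqrt_natCast_pos hs
  have hcast : √(s : ℝ) ^ 2 = s := Real.sq_sqrt s.cast_nonneg
  rw [tiltMoment_zero_inv_sqrt hs hδ, inv_inv, slack, div_eq_iff hr.ne']
  linear_combination sub_carriedLoad s ((√s - δ) * √s) - hcast

theorem overloadGap_sqrt_sub_mul_sqrt (hs : 1 ≤ s) (hδ : δ < √s) :
    overloadGap s ((√s - δ) * √s) =
      s * ((δ + (tiltMoment 0 (1 / √s) δ)⁻¹) * (1 / √s + 2 * (tiltMoment 0 (1 / √s) δ)⁻¹) - 1) := by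
  have hr := sqrt_natCast_pos hs
  have hcast : (s : ℝ) = √(s : ℝ) ^ 2 := (Real.sq_sqrt s.cast_nonneg).symm
  have hslack := slack_mul_sqrt hs ((√s - δ) * √s)
  rw [slack_sqrt_sub_mul_sqrt hs hδ] at hslack
  set A := (tiltMoment 0 (1 / √s) δ)⁻¹
  have hC : carriedLoad s ((√s - δ) * √s) = √s ^ 2 - (δ + A) * √s := by linarith
  rw [overloadGap, hC, hcast, Real.sqrt_sq hr.le]
  field_simp
  ring

end ErlangMass

section CriticalMass

variable {s : ℕ} {γ ε : ℝ}

/-- The value of `a_s(γ)`, `ε = 1 / √s`, for which `γ` solves the critical equation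
`γ a_s(γ) = (1 - γ / √s) / 2`. -/
noncomputable def criticalSol (γ ε : ℝ) : ℝ := 1 / (2 * γ) - ε / 2

/-- The product of `criticalSol γ ε` with the mass at the corresponding `δ = γ - criticalSol γ ε`.
At `ε = 1 / √s` that mass is `1 / f_s(δ)`, so `γ = optSlack s` exactly when the product is `1`. -/
noncomputable def criticalMass (γ ε : ℝ) : ℝ :=
  criticalSol γ ε * tiltMoment 0 ε (γ - criticalSol γ ε)

theorem sub_criticalSol (γ ε : ℝ) : γ - criticalSol γ ε = γ - 1 / (2 * γ) + 1 / 2 * ε := by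
  rw [criticalSol]
  ring

theorem mul_criticalSol (hγ : 0 < γ) (ε : ℝ) : γ * (ε + 2 * criticalSol γ ε) = 1 := by
  rw [criticalSol]
  field_simp
  ring

theorem criticalSol_pos (hγ : 0 < γ) (h : γ * ε < 1) : 0 < criticalSol γ ε := by
  have hmul := mul_criticalSol hγ ε
  exact pos_of_mul_pos_right (a := 2 * γ) (by linarith) (by positivity)

theorem one_sub_sub_criticalSol_mul (hγ : 0 < γ) (ε : ℝ) :
    1 - (γ - criticalSol γ ε) * ε = criticalSol γ ε * (2 * γ + ε) := by
  linear_combination -mul_criticalSol hγ ε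

theorem sub_criticalSol_mul_lt_one (hγ : 0 < γ) (hε : 0 ≤ ε) (h : γ * ε < 1) :
    (γ - criticalSol γ ε) * ε < 1 := by
  have hpos := criticalSol_pos hγ h
  rw [← sub_pos, one_sub_sub_criticalSol_mul hγ]
  positivity

theorem mul_one_div_sqrt_lt_one (hγ : γ ∈ Ioo 0 √(s : ℝ)) : γ * (1 / √s) < 1 := by
  rw [mul_one_div, div_lt_one (hγ.1.trans hγ.2)]
  exact hγ.2

theorem cmp_criticalMass (hs : 1 ≤ s) (hγ : γ ∈ Ioo 0 √(s : ℝ)) :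
    cmp (criticalMass γ (1 / √s)) 1 = cmp γ (optSlack s) := by
  have hγε := mul_one_div_sqrt_lt_one hγ
  have ha := criticalSol_pos hγ.1 hγε
  have hcrit := mul_criticalSol hγ.1 (1 / √s)
  have hV := tiltMoment_pos 0 (by positivity) (sub_criticalSol_mul_lt_one hγ.1 (by positivity) hγε)
  rw [criticalMass]
  set a := criticalSol γ (1 / √s)
  have hδ : γ - a < √s := by linarith [hγ.2]
  have hlam := mul_pos (sub_pos.2 hδ) (sqrt_natCast_pos hs)
  have hslack := slack_sqrt_sub_mul_sqrt hs hδ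
  have hgap := overloadGap_sqrt_sub_mul_sqrt hs hδ
  set V := tiltMoment 0 (1 / √s) (γ - a)
  have hfactor : overloadGap s ((√s - (γ - a)) * √s) =
      s * (2 * γ + 1 / √s + 2 * V⁻¹) * (V⁻¹ - a) := by
    rw [hgap]
    linear_combination (s : ℝ) * hcrit
  have hc : 0 < s * (2 * γ + 1 / √s + 2 * V⁻¹) := by have := hγ.1; positivity
  have hgap_lt := slack_lt_optSlack_iff hs hlam
  have hgap_gt := optSlack_lt_slack_iff hs hlam
  rw [hfactor, mul_pos_iff_of_pos_left hc, sub_pos] at hgap_lt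
  rw [hfactor, ← neg_pos, ← mul_neg, mul_pos_iff_of_pos_left hc, neg_pos, sub_neg] at hgap_gt
  rcases lt_trichotomy a V⁻¹ with h | h | h
  · rw [(cmp_eq_lt_iff _ _).2 ((lt_mul_inv_iff₀ hV).1 (h.trans_eq (one_mul _).symm)), eq_comm,
      cmp_eq_lt_iff]
    linarith [hgap_lt.2 h]
  · rw [h, inv_mul_cancel₀ hV.ne', cmp_self_eq_eq, eq_comm, cmp_eq_eq_iff]
    linarith [not_lt.1 (hgap_lt.not.2 h.not_lt), not_lt.1 (hgap_gt.not.2 h.not_gt)]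
  · rw [(cmp_eq_gt_iff _ _).2 ((inv_lt_iff_one_lt_mul₀ hV).1 h), eq_comm, cmp_eq_gt_iff]
    linarith [hgap_gt.2 h]

theorem criticalMass_lt_one_iff (hs : 1 ≤ s) (hγ : γ ∈ Ioo 0 √(s : ℝ)) :
    criticalMass γ (1 / √s) < 1 ↔ γ < optSlack s :=
  lt_iff_lt_of_cmp_eq_cmp (cmp_criticalMass hs hγ)

theorem one_lt_criticalMass_iff (hs : 1 ≤ s) (hγ : γ ∈ Ioo 0 √(s : ℝ)) :
    1 < criticalMass γ (1 / √s) ↔ optSlack s < γ :=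
  lt_iff_lt_of_cmp_eq_cmp (cmp_eq_cmp_symm.1 (cmp_criticalMass hs hγ))

theorem criticalMass_optSlack (hs : 1 ≤ s) : criticalMass (optSlack s) (1 / √s) = 1 :=
  (eq_iff_eq_of_cmp_eq_cmp (cmp_criticalMass hs (optSlack_mem_Ioo hs))).2 rfl

end CriticalMass

section MonotoneInServers

open MeasureTheory

variable {s : ℕ} {γ ε δ a : ℝ}

/-- By `tiltMoment_succ`, `pⱼ = a * κ ^ j * Mⱼ` for the moments `Mⱼ = tiltMoment j ε δ` when
`a = M₀⁻¹` and `κ = 1 - δ * ε`. -/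
theorem two_mul_lt_mul_sq {κ p₁ p₂ p₃ : ℝ} (hε : 0 < ε) (ha : 0 < a) (hδ : -(ε / 4) ≤ δ)
    (hprod : ε ^ 2 ≤ (δ + a) * (ε + 2 * a)) (hκ : κ = a * (2 * (δ + a) + ε))
    (hp₁ : p₁ = δ + a + ε) (hp₂ : p₂ = (δ + 2 * ε) * p₁ + κ)
    (hp₃ : p₃ = (δ + 3 * ε) * p₂ + 2 * κ * p₁) :
    2 * (κ ^ 2 * p₁ + κ * ε * p₂ + ε ^ 2 / 3 * p₃) < (ε + 2 * a) * p₂ ^ 2 := by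
  obtain ⟨w, hw, rfl⟩ : ∃ w, 0 ≤ w ∧ δ = w - ε / 4 := ⟨δ + ε / 4, by linarith, by ring⟩
  have hnonneg := mul_nonneg (pow_nonneg hε.le 3) (sub_nonneg.2 hprod)
  have hpos : 0 < 201 / 64 * ε ^ 4 * a + 107 / 192 * ε ^ 4 * w + 655 / 96 * ε ^ 3 * a ^ 2 +
      1319 / 96 * ε ^ 3 * a * w + 43 / 8 * ε ^ 3 * w ^ 2 + 299 / 24 * ε ^ 2 * a ^ 3 +
      355 / 12 * ε ^ 2 * a ^ 2 * w + 259 / 12 * ε ^ 2 * a * w ^ 2 + 13 / 3 * ε ^ 2 * w ^ 3 +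
      4 * ε * a ^ 4 + 19 * ε * a ^ 3 * w + 26 * ε * a ^ 2 * w ^ 2 + 12 * ε * a * w ^ 3 +
      ε * w ^ 4 + 2 * a ^ 3 * w ^ 2 + 4 * a ^ 2 * w ^ 3 + 2 * a * w ^ 4 := by positivity
  subst hp₃ hp₂ hp₁ hκ
  linear_combination 35 / 64 * hnonneg + hpos

theorem lt_two_mul_integral_tiltRate (hε : 0 < ε) (hε₁ : ε ≤ 1) (ha : 0 < a)
    (hδ : -(ε / 4) ≤ δ) (hδε : δ * ε < 1) (hcrit : (δ + a) * (ε + 2 * a) = 1)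
    (hmass : a * tiltMoment 0 ε δ = 1) :
    δ + a < 2 * a * (1 - δ * ε) * ∫ y in Ioi (0 : ℝ), tiltRate ε y * tiltWeight ε δ y := by
  have hγ : 0 < δ + a := pos_of_mul_pos_left (hcrit ▸ one_pos) (by positivity)
  have hprod : ε ^ 2 ≤ (δ + a) * (ε + 2 * a) := hcrit ▸ pow_le_one₀ hε.le hε₁
  have hκ_eq : 1 - δ * ε = a * (2 * (δ + a) + ε) := by linear_combination -hcrit
  have hκ : 0 < 1 - δ * ε := sub_pos.2 hδε
  have hcs := sq_tiltMoment_two_le hε.le hδε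
  have hrec₀ := tiltMoment_succ 0 hε.le hδε
  have hrec₁ := tiltMoment_succ 1 hε.le hδε
  have hrec₂ := tiltMoment_succ 2 hε.le hδε
  have hM₁ := tiltMoment_pos 1 hε.le hδε
  have hM₂ := tiltMoment_pos 2 hε.le hδε
  have hM₃ := tiltMoment_pos 3 hε.le hδε
  simp only [Nat.reduceAdd, Nat.reduceSub, pow_zero, Nat.cast_zero, zero_mul, Nat.cast_one,
    pow_one, Nat.cast_ofNat, zero_pow two_ne_zero] at hrec₀ hrec₁ hrec₂
  set κ := 1 - δ * ε
  set I := ∫ y in Ioi (0 : ℝ), tiltRate ε y * tiltWeight ε δ y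
  set V := tiltMoment 0 ε δ
  set M₁ := tiltMoment 1 ε δ
  set M₂ := tiltMoment 2 ε δ
  set M₃ := tiltMoment 3 ε δ
  have hclosed := two_mul_lt_mul_sq (p₁ := a * κ * M₁) (p₂ := a * κ ^ 2 * M₂)
    (p₃ := a * κ ^ 3 * M₃) hε ha hδ hprod hκ_eq
    (by linear_combination a * hrec₀ + (δ + ε) * hmass)
    (by linear_combination a * κ * hrec₁ + κ * hmass)
    (by linear_combination a * κ ^ 2 * hrec₂)
  have hQ : 0 < M₁ + ε * M₂ + ε ^ 2 / 3 * M₃ := by positivity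
  set Q := M₁ + ε * M₂ + ε ^ 2 / 3 * M₃
  have hlt : 2 * a * κ ^ 3 * Q * (δ + a) < 2 * a * κ ^ 3 * Q * (2 * a * κ * I) :=
    calc 2 * a * κ ^ 3 * Q * (δ + a)
        < (ε + 2 * a) * (a * κ ^ 2 * M₂) ^ 2 * (δ + a) := by
          refine mul_lt_mul_of_pos_right (lt_of_eq_of_lt ?_ hclosed) hγ
          ring
      _ = a ^ 2 * κ ^ 4 * M₂ ^ 2 := by linear_combination a ^ 2 * κ ^ 4 * M₂ ^ 2 * hcrit
      _ ≤ a ^ 2 * κ ^ 4 * (4 * I * Q) := by gcongr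
      _ = 2 * a * κ ^ 3 * Q * (2 * a * κ * I) := by ring
  exact lt_of_mul_lt_mul_left hlt (by positivity)

theorem hasDerivAt_criticalMass (hγ : 0 < γ) (hε : 0 < ε) (h : γ * ε < 1) :
    HasDerivAt (criticalMass γ)
      (criticalSol γ ε * (1 / 2 * tiltMoment 1 ε (γ - criticalSol γ ε) +
          ∫ y in Ioi (0 : ℝ), tiltRate ε y * tiltWeight ε (γ - criticalSol γ ε) y) -
        1 / 2 * tiltMoment 0 ε (γ - criticalSol γ ε)) ε := by
  have hlt := sub_criticalSol_mul_lt_one hγ hε.le h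
  have hsol : HasDerivAt (criticalSol γ) (-(1 / 2)) ε :=
    ((hasDerivAt_id ε).div_const 2).const_sub _
  rw [sub_criticalSol] at hlt
  have hmass := hasDerivAt_tiltMoment_zero_path hε hlt
  simp only [← sub_criticalSol] at hmass
  refine (hsol.mul hmass).congr_deriv ?_
  ring

theorem isUpcrossing_criticalMass (hγ : 0 < γ) (hε : 0 < ε) (hε₁ : ε ≤ 1) (h : γ * ε < 1)
    (hδ : -(ε / 4) ≤ γ - criticalSol γ ε) (hmass : criticalMass γ ε = 1) :
    IsUpcrossing (fun t => criticalMass γ t - 1) ε := by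
  have ha := criticalSol_pos hγ h
  have hδε := sub_criticalSol_mul_lt_one hγ hε.le h
  have hcrit := mul_criticalSol hγ ε
  have hκ := one_sub_sub_criticalSol_mul hγ ε
  have hderiv := hasDerivAt_criticalMass hγ hε h
  rw [criticalMass] at hmass
  set a := criticalSol γ ε
  have hI := lt_two_mul_integral_tiltRate hε hε₁ ha hδ hδε (by rwa [sub_add_cancel]) hmass
  have hrec₀ := tiltMoment_succ 0 hε.le hδε
  simp only [Nat.reduceAdd, pow_zero, Nat.cast_zero, zero_mul] at hrec₀
  refine isUpcrossing_of_hasDerivAt_pos (hderiv.sub_const 1) (sub_eq_zero.2 hmass) ?_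
  refine pos_of_mul_pos_right (a := 2 * a * (1 - (γ - a) * ε))
    ((mul_pos ha (sub_pos.2 hI)).trans_eq ?_) (mul_pos (by positivity) (sub_pos.2 hδε)).le
  linear_combination -(a ^ 2) * hrec₀ + (1 - (γ - a) * ε - a * (γ - a + ε)) * hmass + hκ

theorem sub_criticalSol_optSlack_nonneg (hs : 1 ≤ s) :
    0 ≤ optSlack s - criticalSol (optSlack s) (1 / √s) := by
  have hr := sqrt_natCast_pos hs
  have hγ := optSlack_mem_Ioo hs
  have hsol : criticalSol (optSlack s) (1 / √s) = cohenSol s (optSlack s) := by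
    refine mul_left_cancel₀ hγ.1.ne' ?_
    rw [(mul_cohenSol_eq_iff hs hγ).2 rfl]
    linear_combination 1 / 2 * mul_criticalSol hγ.1 (1 / √s)
  rw [hsol, optSlack, cohenSol_slack hs (optLoad_pos hs), slack, ← sub_div]
  exact div_nonneg (by linarith [optLoad_le hs]) hr.le

theorem optSlack_lt_succ (hs : 1 ≤ s) : optSlack s < optSlack (s + 1) := by
  have hr := sqrt_natCast_pos hs
  have hr_succ := sqrt_natCast_pos (Nat.le_add_left 1 s)
  have hr_lt : √(s : ℝ) < √((s + 1 : ℕ) : ℝ) := Real.sqrt_lt_sqrt s.cast_nonneg (by simp)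
  obtain ⟨hγ, hγs⟩ := optSlack_mem_Ioo hs
  have hδ := sub_criticalSol_optSlack_nonneg hs
  have hε : 1 / √(s : ℝ) ≤ 3 / 2 * (1 / √((s + 1 : ℕ) : ℝ)) := by
    rw [mul_one_div, div_le_div_iff₀ hr hr_succ, one_mul, Real.sqrt_le_left (by positivity),
      mul_pow, Real.sq_sqrt s.cast_nonneg]
    have : (1 : ℝ) ≤ s := mod_cast hs
    push_cast
    linarith
  have hε_lt : 1 / √((s + 1 : ℕ) : ℝ) < 1 / √s := one_div_lt_one_div_of_lt hr hr_lt
  have hε_le : 1 / √(s : ℝ) ≤ 1 := by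
    rw [div_le_one hr, Real.one_le_sqrt]
    exact mod_cast hs
  have hmul {t : ℝ} (ht : t ≤ 1 / √s) : optSlack s * t < 1 :=
    (mul_le_mul_of_nonneg_left ht hγ.le).trans_lt (mul_one_div_sqrt_lt_one ⟨hγ, hγs⟩)
  rw [← criticalMass_lt_one_iff (Nat.le_add_left 1 s) ⟨hγ, hγs.trans hr_lt⟩]
  by_contra! hge
  have hpos {t : ℝ} (ht : t ∈ Icc (1 / √((s + 1 : ℕ) : ℝ)) (1 / √s)) : 0 < t :=
    (one_div_pos.2 hr_succ).trans_le ht.1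
  have hgt : 0 < criticalMass (optSlack s) (1 / √s) - 1 := by
    refine pos_of_isUpcrossing (F := fun t => criticalMass (optSlack s) t - 1) hε_lt
      (fun t ht => ?_) (fun t ht hzero => ?_) (sub_nonneg.2 hge)
    · exact ((hasDerivAt_criticalMass hγ (hpos ht) (hmul ht.2)).sub_const
        1).continuousAt.continuousWithinAt
    · refine isUpcrossing_criticalMass hγ (hpos ht) (ht.2.trans hε_le) (hmul ht.2) ?_
        (sub_eq_zero.1 hzero)
      rw [sub_criticalSol] at hδ ⊢
      linarith [ht.1]
  exact hgt.ne' (sub_eq_zero.2 (criticalMass_optSlack hs))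

theorem strictMonoOn_optSlack : StrictMonoOn optSlack (Ici 1) :=
  strictMonoOn_of_lt_succ ordConnected_Ici fun _ _ hs _ => optSlack_lt_succ hs

end MonotoneInServers

section ManyServers

variable {γ lo hi : ℝ}

theorem criticalMass_zero_right (γ : ℝ) :
    criticalMass γ 0 = 1 / (2 * γ) * tiltMoment 0 0 (γ - 1 / (2 * γ)) := by
  rw [criticalMass, criticalSol, zero_div, sub_zero]

theorem continuousWithinAt_criticalMass_zero (γ : ℝ) :
    ContinuousWithinAt (criticalMass γ) (Ici 0) 0 := by
  have hsol : Tendsto (criticalSol γ) (𝓝[≥] 0) (𝓝 (criticalSol γ 0)) :=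
    Continuous.continuousWithinAt (continuous_const.sub (continuous_id.div_const 2))
  exact hsol.mul (tendsto_tiltMoment 0 le_rfl (by simp)
    (tendsto_id.mono_left nhdsWithin_le_nhds) (hsol.const_sub γ) self_mem_nhdsWithin)

theorem tendsto_criticalMass_one_div_sqrt (γ : ℝ) :
    Tendsto (fun s : ℕ => criticalMass γ (1 / √s)) atTop (𝓝 (criticalMass γ 0)) := by
  have hε : Tendsto (fun s : ℕ => 1 / √(s : ℝ)) atTop (𝓝 0) :=
    (Real.tendsto_sqrt_atTop.comp tendsto_natCast_atTop_atTop).const_div_atTop 1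
  exact (continuousWithinAt_criticalMass_zero γ).tendsto.comp
    (tendsto_nhdsWithin_iff.2 ⟨hε, .of_forall fun s => one_div_nonneg.2 (Real.sqrt_nonneg _)⟩)

theorem eventually_mem_Ioo_zero_sqrt (hγ : 0 < γ) : ∀ᶠ s : ℕ in atTop, γ ∈ Ioo 0 √(s : ℝ) :=
  ((Real.tendsto_sqrt_atTop.comp tendsto_natCast_atTop_atTop).eventually_gt_atTop γ).mono
    fun _ h => ⟨hγ, h⟩

theorem eventually_lt_optSlack (hγ : 0 < γ) (h : criticalMass γ 0 < 1) :
    ∀ᶠ s in atTop, γ < optSlack s := by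
  filter_upwards [(tendsto_criticalMass_one_div_sqrt γ).eventually_lt_const h,
    eventually_mem_Ioo_zero_sqrt hγ, eventually_ge_atTop 1] with s hlt hmem hs
  exact (criticalMass_lt_one_iff hs hmem).1 hlt

theorem eventually_optSlack_lt (hγ : 0 < γ) (h : 1 < criticalMass γ 0) :
    ∀ᶠ s in atTop, optSlack s < γ := by
  filter_upwards [(tendsto_criticalMass_one_div_sqrt γ).eventually_const_lt h,
    eventually_mem_Ioo_zero_sqrt hγ, eventually_ge_atTop 1] with s hlt hmem hs
  exact (one_lt_criticalMass_iff hs hmem).1 hlt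

theorem exists_tendsto_optSlack_mem_Icc (hlo : 0 < lo) (hhi : 0 < hi)
    (hlo_mass : criticalMass lo 0 < 1) (hhi_mass : 1 < criticalMass hi 0) :
    ∃ l ∈ Icc lo hi, Tendsto optSlack atTop (𝓝 l) := by
  have hlo_lt := eventually_lt_optSlack hlo hlo_mass
  have hlt_hi := eventually_optSlack_lt hhi hhi_mass
  have hmono : Monotone fun n => optSlack (n + 1) := fun m n hmn =>
    strictMonoOn_optSlack.monotoneOn (Nat.le_add_left 1 m) (Nat.le_add_left 1 n)
      (Nat.add_le_add_right hmn 1)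
  obtain htop | ⟨l, hl⟩ := tendsto_atTop_of_monotone hmono
  · obtain ⟨n, hgt, hlt⟩ := ((htop.eventually_gt_atTop hi).and
      ((tendsto_add_atTop_nat 1).eventually hlt_hi)).exists
    exact absurd hgt hlt.not_gt
  · have hl : Tendsto optSlack atTop (𝓝 l) := (tendsto_add_atTop_iff_nat 1).1 hl
    exact ⟨l, ⟨ge_of_tendsto hl (hlo_lt.mono fun _ h => h.le),
      le_of_tendsto hl (hlt_hi.mono fun _ h => h.le)⟩, hl⟩

end ManyServers

theorem optSlack_one : optSlack 1 = 1 / 2 := by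
  have hC : carriedLoad 1 1 = 1 / 2 := by
    norm_num [carriedLoad, erlangB, Finset.sum_range_succ]
  have hgap : overloadGap 1 1 = 0 := by
    rw [overloadGap, hC]
    norm_num
  rw [optSlack, ← (overloadGap_eq_zero_iff le_rfl one_pos).1 hgap, slack, hC]
  norm_num

section ErlangEnclosure

variable {N p q k M : ℕ}

/-- Integer recursion for `N / erlangB k (p / q)`, from `1 / B_{k+1} = 1 + (k + 1) / lam / B_k`.
Each division is rounded down and then increased by `r`, so that `r = 0` gives lower and `r = 1`
gives upper bounds. -/
def invErlangApprox (r N p q : ℕ) : ℕ → ℕ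
  | 0 => N
  | k + 1 => N + (q * (k + 1) * invErlangApprox r N p q k / p + r)

theorem inv_erlangB_succ (s : ℕ) {lam : ℝ} (h : 0 < lam) :
    (erlangB (s + 1) lam)⁻¹ = 1 + (s + 1) / lam * (erlangB s lam)⁻¹ := by
  have := erlangB_pos s h
  rw [erlangB_succ s h]
  field_simp
  ring

theorem mul_inv_erlangB_succ (N k : ℕ) (hp : 0 < p) (hq : 0 < q) :
    N * (erlangB (k + 1) (p / q))⁻¹ =
      N + (q * (k + 1 : ℕ)) * (N * (erlangB k (p / q))⁻¹) / p := by
  have hp : (0 : ℝ) < p := Nat.cast_pos.2 hp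
  have hq : (0 : ℝ) < q := Nat.cast_pos.2 hq
  rw [inv_erlangB_succ k (div_pos hp hq), Nat.cast_succ]
  field_simp

theorem invErlangApprox_zero_le (N : ℕ) (hp : 0 < p) (hq : 0 < q) (k : ℕ) :
    invErlangApprox 0 N p q k ≤ N * (erlangB k (p / q))⁻¹ := by
  induction k with
  | zero => rw [invErlangApprox, erlangB_zero, inv_one, mul_one]
  | succ k ih =>
    rw [mul_inv_erlangB_succ N k hp hq, invErlangApprox, add_zero, Nat.cast_add]
    gcongr
    refine Nat.cast_div_le.trans ?_
    rw [Nat.cast_mul, Nat.cast_mul]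
    gcongr

theorem le_invErlangApprox_one (N : ℕ) (hp : 0 < p) (hq : 0 < q) (k : ℕ) :
    N * (erlangB k (p / q))⁻¹ ≤ invErlangApprox 1 N p q k := by
  induction k with
  | zero => rw [invErlangApprox, erlangB_zero, inv_one, mul_one]
  | succ k ih =>
    have hdiv : ((q * (k + 1) * invErlangApprox 1 N p q k : ℕ) : ℝ) / p ≤
        (q * (k + 1) * invErlangApprox 1 N p q k / p + 1 : ℕ) := by
      rw [div_le_iff₀ (Nat.cast_pos.2 hp)]
      exact mod_cast (Nat.lt_mul_of_div_lt (Nat.lt_succ_self _) hp).le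
    rw [mul_inv_erlangB_succ N k hp hq, invErlangApprox, Nat.cast_add (m := N)]
    refine add_le_add_right (le_trans ?_ hdiv) _
    rw [Nat.cast_mul, Nat.cast_mul]
    gcongr

theorem erlangB_le_div (hp : 0 < p) (hq : 0 < q) (hM : 0 < M)
    (h : M ≤ invErlangApprox 0 N p q k) : erlangB k (p / q) ≤ N / M := by
  have hB := erlangB_pos k (div_pos (Nat.cast_pos.2 hp) (Nat.cast_pos.2 hq) : (0 : ℝ) < p / q)
  have hle := (Nat.cast_le.2 h).trans (invErlangApprox_zero_le N hp hq k)
  rwa [← div_eq_mul_inv, le_div_comm₀ (Nat.cast_pos.2 hM) hB] at hle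

theorem div_le_erlangB (hp : 0 < p) (hq : 0 < q) (h : invErlangApprox 1 N p q k ≤ M) :
    N / M ≤ erlangB k (p / q) := by
  have hB := erlangB_pos k (div_pos (Nat.cast_pos.2 hp) (Nat.cast_pos.2 hq) : (0 : ℝ) < p / q)
  have hle := (le_invErlangApprox_one N hp hq k).trans (Nat.cast_le.2 h)
  rw [← div_eq_mul_inv, div_le_iff₀ hB, mul_comm] at hle
  exact div_le_of_le_mul₀ M.cast_nonneg hB.le hle

theorem optSlack_550_lt : optSlack 550 < 1 + 1 / 1000 := by
  have hB : erlangB 550 (5378 / 10) ≤ 10 ^ 15 / (47873 * 10 ^ 12) := mod_cast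
    erlangB_le_div (N := 10 ^ 15) (M := 47873 * 10 ^ 12) (p := 5378) (q := 10) (k := 550)
      (by norm_num) (by norm_num) (by norm_num) (by decide +kernel)
  have hB_pos : 0 < erlangB 550 (5378 / 10) := erlangB_pos 550 (by norm_num)
  have hgap : overloadGap 550 (5378 / 10) < 0 := by
    rw [overloadGap, carriedLoad, Nat.cast_ofNat]
    nlinarith
  have hsqrt : 23.452 ≤ √((550 : ℕ) : ℝ) := Real.le_sqrt_of_sq_le (by norm_num)
  calc optSlack 550 < slack 550 (5378 / 10) :=
        (optSlack_lt_slack_iff (by norm_num) (by norm_num)).2 hgap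
    _ ≤ 1 + 1 / 1000 := by
      rw [slack, carriedLoad, div_le_iff₀ (sqrt_natCast_pos (by norm_num))]
      rw [Nat.cast_ofNat] at hsqrt ⊢
      linarith

theorem lt_optSlack_550 : 1 - 1 / 1000 < optSlack 550 := by
  have hB : 10 ^ 15 / (47857 * 10 ^ 12) ≤ erlangB 550 (537808 / 1000) := mod_cast
    div_le_erlangB (N := 10 ^ 15) (M := 47857 * 10 ^ 12) (p := 537808) (q := 1000) (k := 550)
      (by norm_num) (by norm_num) (by decide +kernel)
  have hgap : 0 < overloadGap 550 (537808 / 1000) := by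
    rw [overloadGap, carriedLoad, Nat.cast_ofNat]
    nlinarith
  have hsqrt : √((550 : ℕ) : ℝ) ≤ 23.4521 := Real.sqrt_le_iff.2 (by norm_num)
  calc 1 - 1 / 1000 ≤ slack 550 (537808 / 1000) := by
        rw [slack, carriedLoad, le_div_iff₀ (sqrt_natCast_pos (by norm_num))]
        rw [Nat.cast_ofNat] at hsqrt ⊢
        linarith
    _ < optSlack 550 := (slack_lt_optSlack_iff (by norm_num) (by norm_num)).2 hgap

theorem abs_optSlack_550_sub_one_lt : |optSlack 550 - 1| < 1 / 1000 :=
  abs_sub_lt_iff.2 ⟨sub_left_lt_of_lt_add optSlack_550_lt, sub_lt_comm.1 lt_optSlack_550⟩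

end ErlangEnclosure

section GaussianMass

open MeasureTheory
open scoped Nat

variable {x δ : ℝ}

theorem tiltExponent_zero_left (y : ℝ) : tiltExponent 0 y = y ^ 2 / 2 := by
  simp [tiltExponent]

theorem tiltMoment_zero_zero (δ : ℝ) :
    tiltMoment 0 0 δ =
      Real.exp (δ ^ 2 / 2) * (√(2 * Real.pi) / 2 + ∫ t in 0..δ, Real.exp (-(1 / 2) * t ^ 2)) := by
  set f : ℝ → ℝ := fun t => Real.exp (-(1 / 2) * t ^ 2)
  have hinteg : Integrable f := integrable_exp_neg_mul_sq (by norm_num)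
  have hweight (y : ℝ) : y ^ 0 * tiltWeight 0 δ y = Real.exp (δ ^ 2 / 2) * f (y - δ) := by
    rw [pow_zero, one_mul, tiltWeight, tiltExponent_zero_left, ← Real.exp_add]
    ring_nf
  have hshift : ∫ y in Ioi 0, f (y - δ) = ∫ t in Ioi (-δ), f t := by
    have h := (measurePreserving_sub_right volume δ).setIntegral_preimage_emb
      (measurableEmbedding_subRight δ) f (Ioi (-δ))
    rwa [preimage_sub_const_Ioi, neg_add_cancel] at h
  have heven : ∫ t in 0..δ, f t = ∫ t in -δ..0, f t := by
    simpa [f] using intervalIntegral.integral_comp_neg (a := 0) (b := δ) f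
  have hhalf : ∫ t in Ioi 0, f t = √(2 * Real.pi) / 2 := by
    rw [integral_gaussian_Ioi, div_div_eq_mul_div, div_one, mul_comm]
  simp only [tiltMoment, hweight]
  rw [integral_const_mul, hshift, heven, ← hhalf, add_comm,
    intervalIntegral.integral_interval_add_Ioi hinteg.integrableOn hinteg.integrableOn]

/-- The partial sum with `n` terms of the power series of Dawson's integral
`exp (x² / 2) ∫₀ˣ exp (-t² / 2) dt`. -/
noncomputable def dawsonSum (n : ℕ) (x : ℝ) : ℝ :=
  ∑ k ∈ Finset.range n, x ^ (2 * k + 1) / (2 * k + 1)‼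

theorem cast_doubleFactorial_two_mul_add_one (n : ℕ) :
    ((2 * n + 1)‼ : ℝ) = (2 * n + 1 : ℕ) * (2 * n - 1)‼ :=
  mod_cast Nat.doubleFactorial_add_one (2 * n)

theorem hasDerivAt_dawsonSum (n : ℕ) (x : ℝ) :
    HasDerivAt (dawsonSum n) (1 + x * dawsonSum n x - x ^ (2 * n) / (2 * n - 1)‼) x := by
  induction n with
  | zero =>
    have hzero : dawsonSum 0 = fun _ => 0 := funext fun _ => Finset.sum_range_zero _
    simpa [hzero] using hasDerivAt_const x (0 : ℝ)
  | succ n ih =>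
    have hfact := cast_doubleFactorial_two_mul_add_one n
    have hpos : (0 : ℝ) < (2 * n - 1)‼ := Nat.cast_pos.2 (Nat.doubleFactorial_pos _)
    have hsum (x : ℝ) : dawsonSum (n + 1) x = dawsonSum n x + x ^ (2 * n + 1) / (2 * n + 1)‼ :=
      Finset.sum_range_succ _ n
    rw [funext hsum]
    refine (ih.add ((hasDerivAt_pow (2 * n + 1) x).div_const _)).congr_deriv ?_
    rw [show 2 * (n + 1) - 1 = 2 * n + 1 by lia, Nat.add_sub_cancel, hfact]
    field_simp
    ring

theorem integral_exp_neg_sq_eq (n : ℕ) (x : ℝ) :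
    ∫ t in 0..x, Real.exp (-(1 / 2) * t ^ 2) = Real.exp (-(1 / 2) * x ^ 2) * dawsonSum n x +
      ∫ t in 0..x, Real.exp (-(1 / 2) * t ^ 2) * (t ^ (2 * n) / (2 * n - 1)‼) := by
  have hderiv (t : ℝ) : HasDerivAt (fun t => Real.exp (-(1 / 2) * t ^ 2) * dawsonSum n t)
      (Real.exp (-(1 / 2) * t ^ 2) -
        Real.exp (-(1 / 2) * t ^ 2) * (t ^ (2 * n) / (2 * n - 1)‼)) t := by
    refine ((((hasDerivAt_pow 2 t).const_mul (-(1 / 2))).exp).mul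
      (hasDerivAt_dawsonSum n t)).congr_deriv ?_
    push_cast
    ring
  have hcont : Continuous fun t : ℝ => Real.exp (-(1 / 2) * t ^ 2) := by fun_prop
  have hcont' : Continuous fun t : ℝ =>
      Real.exp (-(1 / 2) * t ^ 2) * (t ^ (2 * n) / (2 * n - 1)‼) := by fun_prop
  have hFTC := intervalIntegral.integral_eq_sub_of_hasDerivAt (fun t _ => hderiv t)
    ((hcont.sub hcont').intervalIntegrable 0 x)
  rw [intervalIntegral.integral_sub (hcont.intervalIntegrable 0 x)
    (hcont'.intervalIntegrable 0 x)] at hFTC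
  have hzero : dawsonSum n 0 = 0 := Finset.sum_eq_zero fun k _ => by simp
  rw [hzero, mul_zero] at hFTC
  linarith

theorem integral_exp_neg_sq_mul_pow_mem_Icc (n : ℕ) (hx : 0 ≤ x) :
    ∫ t in 0..x, Real.exp (-(1 / 2) * t ^ 2) * (t ^ (2 * n) / (2 * n - 1)‼) ∈
      Icc 0 (x ^ (2 * n + 1) / (2 * n + 1)‼) := by
  constructor
  · refine intervalIntegral.integral_nonneg hx fun t _ => ?_
    have := (even_two_mul n).pow_nonneg t
    positivity
  · calc ∫ t in 0..x, Real.exp (-(1 / 2) * t ^ 2) * (t ^ (2 * n) / (2 * n - 1)‼)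
        ≤ ∫ t in 0..x, t ^ (2 * n) / (2 * n - 1)‼ := by
          refine intervalIntegral.integral_mono_on hx
            (Continuous.intervalIntegrable (by fun_prop) _ _)
            (Continuous.intervalIntegrable (by fun_prop) _ _) fun t _ => ?_
          have := (even_two_mul n).pow_nonneg t
          exact mul_le_of_le_one_left (by positivity)
            (Real.exp_le_one_iff.2 (by linarith [sq_nonneg t]))
      _ = x ^ (2 * n + 1) / (2 * n + 1)‼ := by
          rw [intervalIntegral.integral_div, integral_pow, zero_pow (Nat.succ_ne_zero _), sub_zero,
            cast_doubleFactorial_two_mul_add_one, div_div]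
          norm_cast

theorem tiltMoment_zero_zero_mem_Icc (n : ℕ) (hδ : 0 ≤ δ) :
    tiltMoment 0 0 δ ∈ Icc (Real.exp (δ ^ 2 / 2) * (√(2 * Real.pi) / 2) + dawsonSum n δ)
      (Real.exp (δ ^ 2 / 2) * (√(2 * Real.pi) / 2 + δ ^ (2 * n + 1) / (2 * n + 1)‼) +
        dawsonSum n δ) := by
  obtain ⟨hnonneg, hle⟩ := integral_exp_neg_sq_mul_pow_mem_Icc n hδ
  have hexp : Real.exp (δ ^ 2 / 2) * Real.exp (-(1 / 2) * δ ^ 2) = 1 := by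
    rw [← Real.exp_add, Real.exp_eq_one_iff]
    ring
  rw [tiltMoment_zero_zero, integral_exp_neg_sq_eq n]
  set R := ∫ t in 0..δ, Real.exp (-(1 / 2) * t ^ 2) * (t ^ (2 * n) / (2 * n - 1)‼)
  have hsplit : Real.exp (δ ^ 2 / 2) *
      (√(2 * Real.pi) / 2 + (Real.exp (-(1 / 2) * δ ^ 2) * dawsonSum n δ + R)) =
      Real.exp (δ ^ 2 / 2) * (√(2 * Real.pi) / 2 + R) + dawsonSum n δ := by
    linear_combination dawsonSum n δ * hexp
  rw [hsplit]
  constructor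
  · gcongr
    exact le_add_of_nonneg_right hnonneg
  · gcongr

end GaussianMass

section LimitEnclosure

open MeasureTheory

theorem monotone_tiltMoment_zero_zero : Monotone (tiltMoment 0 0) := fun δ₁ δ₂ hδ =>
  setIntegral_mono_on (integrableOn_pow_mul_tiltWeight 0 le_rfl (by simp))
    (integrableOn_pow_mul_tiltWeight 0 le_rfl (by simp)) measurableSet_Ioi fun y hy =>
      mul_le_mul_of_nonneg_left (tiltWeight_mono le_rfl le_rfl hδ (mem_Ioi.1 hy).le)
        (pow_nonneg (mem_Ioi.1 hy).le 0)

theorem sqrt_two_mul_pi_div_two_mem_Icc :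
    √(2 * Real.pi) / 2 ∈ Icc 1.2533141373155 1.2533141373156 := by
  rw [mem_Icc, le_div_iff₀ two_pos, div_le_iff₀ two_pos, Real.sqrt_le_left (by norm_num),
    Real.le_sqrt' (by norm_num)]
  constructor <;> linarith [Real.pi_gt_d20, Real.pi_lt_d20]

theorem tiltMoment_zero_zero_lt : tiltMoment 0 0 0.55060751981 < 2 * 1.03411345951 := by
  have hexp : Real.exp (0.55060751981 ^ 2 / 2) ≤ 1.163676419376 :=
    (Real.exp_bound' (by norm_num) (by norm_num) (n := 10) (by norm_num)).trans (by
      norm_num [Finset.sum_range_succ, Nat.factorial])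
  have hdawson : dawsonSum 8 0.55060751981 ≤ 0.60977481133 := by
    norm_num [dawsonSum, Finset.sum_range_succ, Nat.doubleFactorial]
  have hrem :
      (0.55060751981 : ℝ) ^ (2 * 8 + 1) / (Nat.doubleFactorial (2 * 8 + 1)) ≤ 2 / 10 ^ 12 := by
    norm_num [Nat.doubleFactorial]
  calc tiltMoment 0 0 0.55060751981
      ≤ _ := (tiltMoment_zero_zero_mem_Icc 8 (by norm_num)).2
    _ ≤ 1.163676419376 * (1.2533141373156 + 2 / 10 ^ 12) + 0.60977481133 := by
      gcongr
      exact sqrt_two_mul_pi_div_two_mem_Icc.2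
    _ < 2 * 1.03411345951 := by norm_num

theorem lt_tiltMoment_zero_zero : 2 * 1.03411345959 < tiltMoment 0 0 0.55060751992 := by
  have hexp : 1.163676419446 ≤ Real.exp (0.55060751992 ^ 2 / 2) :=
    le_trans (by norm_num [Finset.sum_range_succ, Nat.factorial])
      (Real.sum_le_exp_of_nonneg (by norm_num) 10)
  have hdawson : 0.609774811476 ≤ dawsonSum 8 0.55060751992 := by
    norm_num [dawsonSum, Finset.sum_range_succ, Nat.doubleFactorial]
  calc 2 * 1.03411345959 < 1.163676419446 * 1.2533141373155 + 0.609774811476 := by norm_num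
    _ ≤ Real.exp (0.55060751992 ^ 2 / 2) * (√(2 * Real.pi) / 2) + dawsonSum 8 0.55060751992 := by
      gcongr
      exact sqrt_two_mul_pi_div_two_mem_Icc.1
    _ ≤ tiltMoment 0 0 0.55060751992 := (tiltMoment_zero_zero_mem_Icc 8 (by norm_num)).1

theorem exists_tendsto_optSlack :
    ∃ l, Tendsto optSlack atTop (𝓝 l) ∧ 1.0341134595 < l ∧ l < 1.0341134596 := by
  have hlo : criticalMass 1.03411345951 0 < 1 := by
    rw [criticalMass_zero_right, one_div_mul_eq_div, div_lt_one (by norm_num)]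
    exact (monotone_tiltMoment_zero_zero (by norm_num)).trans_lt tiltMoment_zero_zero_lt
  have hhi : 1 < criticalMass 1.03411345959 0 := by
    rw [criticalMass_zero_right, one_div_mul_eq_div, one_lt_div (by norm_num)]
    exact lt_tiltMoment_zero_zero.trans_le (monotone_tiltMoment_zero_zero (by norm_num))
  obtain ⟨l, ⟨hlo_le, hle_hi⟩, hl⟩ :=
    exists_tendsto_optSlack_mem_Icc (by norm_num) (by norm_num) hlo hhi
  exact ⟨l, hl, lt_of_lt_of_le (by norm_num) hlo_le, hle_hi.trans_lt (by norm_num)⟩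

end LimitEnclosure

theorem mainTheorem7 :
    -- Cohen's equation has exactly one solution, so that `cohenSol s γ` is that solution
    (∀ s : ℕ, 1 ≤ s → ∀ γ ∈ Ioo (0 : ℝ) √s, ∃! a : ℝ, IsCohenSolution s γ a) ∧
    -- range of `L_s`
    (∀ s : ℕ, 1 ≤ s → ∀ γ ∈ Ioo (0 : ℝ) √s, carriedL s γ ∈ Ioo 0 (√s - γ)) ∧
    -- asymptotics as `γ ↓ 0` and as `γ ↑ √s`, with constants that do not depend on `s`
    (∃ C : ℝ, ∀ s : ℕ, 1 ≤ s → ∀ᶠ γ in 𝓝[>] (0 : ℝ),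
      |carriedL s γ - γ * s| ≤ γ * s * (C * (γ * √s))) ∧
    (∃ C : ℝ, ∀ s : ℕ, 1 ≤ s → ∀ᶠ γ in 𝓝[<] √(s : ℝ),
      |carriedL s γ - (√s - γ)| ≤
        (√s - γ) * (C * (Real.exp s / √s * (1 - γ / √s) ^ s))) ∧
    ∃ γhat : ℕ → ℝ,
      (∀ s : ℕ, 1 ≤ s →
        -- `γhat s` is the unique root
        γhat s ∈ Ioo (0 : ℝ) √s ∧
        (∀ γ ∈ Ioo (0 : ℝ) √s, γ * cohenSol s γ = 1 / 2 * (1 - γ / √s) ↔ γ = γhat s) ∧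
        -- unimodality, with the maximum at `γhat s`, and the maximum value
        StrictMonoOn (carriedL s) (Ioc 0 (γhat s)) ∧
        StrictAntiOn (carriedL s) (Ico (γhat s) √s) ∧
        (∀ γ ∈ Ioo (0 : ℝ) √s, γ ≠ γhat s → carriedL s γ < carriedL s (γhat s)) ∧
        carriedL s (γhat s) = γhat s / (γhat s + 1 / (2 * √s)) * (√s - γhat s)) ∧
      -- lower bounds
      (∀ s : ℕ, 2 ≤ s →
        lossF s 0 < γhat s ∧
        √(1 / 2 + 1 / (16 * (s : ℝ))) - 1 / (4 * √s) < lossF s 0) ∧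
      -- monotonicity in `s` and the values at `s = 1`, `s = 550` and `s = ∞`
      StrictMonoOn γhat (Ici 1) ∧
      γhat 1 = 1 / 2 ∧
      |γhat 550 - 1| < 1 / 1000 ∧
      ∃ l : ℝ, Tendsto γhat atTop (𝓝 l) ∧ 1.0341134595 < l ∧ l < 1.0341134596 := by
  refine ⟨fun s hs γ hγ => existsUnique_isCohenSolution hs hγ,
    fun s hs γ hγ => carriedL_mem_Ioo hs hγ, ⟨2, fun s hs => ?_⟩,
    ⟨2, fun s hs => eventually_abs_carriedL_sub_le hs⟩, optSlack,
    fun s hs => ⟨optSlack_mem_Ioo hs, fun γ hγ => mul_cohenSol_eq_iff hs hγ,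
      strictMonoOn_carriedL hs, strictAntiOn_carriedL hs,
      fun γ hγ hne => carriedL_lt_carriedL_optSlack hs hγ hne, carriedL_optSlack hs⟩,
    fun s hs => ⟨lossF_zero_lt_optSlack hs, lt_lossF_zero hs⟩, strictMonoOn_optSlack,
    optSlack_one, abs_optSlack_550_sub_one_lt, exists_tendsto_optSlack⟩
  filter_upwards [Ioo_mem_nhdsGT (sqrt_natCast_pos hs)] with γ hγ
  exact abs_carriedL_sub_mul_le hs hγ
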